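/- Let $\mathcal D$ be a probability distribution on $\mathcal X\times\mathcal Y$, $\ell:\mathcal Z\times\mathcal Y\to[0,1]$ a loss, and $\mathcal H$ a finite set of hypotheses $h:\mathcal X\to\mathcal Z$ such that $(x,y)\mapsto\ell(h(x),y)$ is measurable for every $h\in\mathcal H$. Let $L(h)=\mathbb E_{(x,y)\sim\mathcal D}[\ell(h(x),y)]$, let $h^*\in\mathcal H$ be a minimizer of $L$ over $\mathcal H$, let $\rho_S(f,g)=\mathbb E_{(x,y)\sim\mathcal D}|\ell(f(x),y)-\ell(g(x),y)|$, $\mathcal B_S(h^*,r)=\{h\in\mathcal H:\rho_S(h,h^*)\le r\}$ and $$\theta_S=\sup_{r>0}\frac1r\,\mathbb E_{(x,y)\sim\mathcal D}\Big[\max_{h\in\mathcal B_S(h^*,r)}|\ell(h(x),y)-\ell(h^*(x),y)|\Big].$$ Given $\delta>0$ and a number $T$ of rounds, the Enhanced-IWeS-V algorithm receives i.i.d. examples $(x_1,y_1),\dots,(x_T,y_T)$ from $\mathcal D$ and starts with $\mathcal H_1=\mathcal H$. In round $t$ it sets $p_t=\max_{f,g\in\mathcal H_t}\big(\ell(f(x_t),y_t)-\ell(g(x_t),y_t)\big)$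 and flips a coin $Q_t\in\{0,1\}$ with bias $p_t$ (given the past and $(x_t,y_t)$); the example is selected if $Q_t=1$. With $L_t(h)=\frac1t\sum_{s=1}^t\frac{Q_s}{p_s}\ell(h(x_s),y_s)$, it then sets $$\mathcal H_{t+1}=\Big\{h\in\mathcal H_t: L_t(h)\le\min_{h'\in\mathcal H_t}L_t(h')+\Delta_t\Big\},$$ $$\Delta_t=\frac2t\Big(\sqrt{\textstyle\sum_{s=1}^tp_s}+6\sqrt{\log\big((3+t)t^2/\delta\big)}\Big)\sqrt{\log\big(8T^2|\mathcal H|^2\log(T)/\delta\big)}.$$ Let $\mathcal F_t$ be the $\sigma$-algebra generated by $(x_s,y_s,Q_s)$, $1\le s\le t$. Theorem. For every $N\in\mathbb N$ there is a constant $C>0$, depending only on $N$, such that in every setting as above with $|\mathcal H|=N$, for every $\delta>0$ and every $T\ge3$, with probability at least $1-\delta$, $$\sum_{t=1}^T\mathbb E[p_t\mid\mathcal F_{t-1}]\le\theta_S\Big(4L(h^*)T+C\sqrt{L(h^*)\,T\log(T/\delta)}\Big)+C\log^3(T/\delta).$$ In particular, if $L(h^*)=0$ (the realizable case), then with probability at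 least $1-\delta$ the expected sampling rate $\sum_{t=1}^T\mathbb E[p_t\mid\mathcal F_{t-1}]$ is at most $C\log^3(T/\delta)$, which is polylogarithmic in $T$. -/

import Mathlib

open MeasureTheory ProbabilityTheory

noncomputable section

namespace EIWeS

variable {X Y Z Ω : Type*}

section Learning

variable [MeasurableSpace X] [MeasurableSpace Y]

/-- Expected loss `L(h) = E_{(x,y) ∼ D} ℓ(h(x), y)`. -/
def risk (D : Measure (X × Y)) (ℓ : Z → Y → ℝ) (h : X → Z) : ℝ :=
  ∫ e, ℓ (h e.1) e.2 ∂D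

/-- `ρ_S(f, g) = E_{(x,y) ∼ D} |ℓ(f(x), y) - ℓ(g(x), y)|`. -/
def rhoS (D : Measure (X × Y)) (ℓ : Z → Y → ℝ) (f g : X → Z) : ℝ :=
  ∫ e, |ℓ (f e.1) e.2 - ℓ (g e.1) e.2| ∂D

/-- `B_S(h⋆, r) = {h ∈ H : ρ_S(h, h⋆) ≤ r}`. -/
def ballS (D : Measure (X × Y)) (ℓ : Z → Y → ℝ) (H : Finset (X → Z)) (hs : X → Z) (r : ℝ) :
    Set (X → Z) :=
  {h | h ∈ H ∧ rhoS D ℓ h hs ≤ r}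

/-- The disagreement coefficient in the subset selection setting,
`θ_S = sup_{r > 0} E_{(x,y) ∼ D} [max_{h ∈ B_S(h⋆, r)} |ℓ(h(x), y) - ℓ(h⋆(x), y)|] / r`.
(At `r = 0` the expectation vanishes, so that `r = 0` contributes nothing. For a finite `H` the
quotients are bounded by the number of elements of `H`, so that this is a true supremum.) -/
def thetaS (D : Measure (X × Y)) (ℓ : Z → Y → ℝ) (H : Finset (X → Z)) (hs : X → Z) : ℝ :=
  ⨆ r : Set.Ioi (0 : ℝ),
    (∫ e, (⨆ h : ballS D ℓ H hs (r : ℝ), |ℓ ((h : X → Z) e.1) e.2 - ℓ (hs e.1) e.2|) ∂D) / (r : ℝ)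

end Learning

section Algorithm

/-- Sampling probability of the example `e = (x, y)` for the version space `V`:
`max_{f, g ∈ V} (ℓ(f(x), y) - ℓ(g(x), y))`. -/
def disagreement (ℓ : Z → Y → ℝ) (V : Finset (X → Z)) (e : X × Y) : ℝ :=
  ⨆ fg : V × V, (ℓ ((fg.1 : X → Z) e.1) e.2 - ℓ ((fg.2 : X → Z) e.1) e.2)

/-- The slack after `t` examples whose sampling probabilities add up to `P`; `N` is the number of
hypotheses, `T` the total number of rounds. -/
def slack (T N : ℕ) (δ : ℝ) (t : ℕ) (P : ℝ) : ℝ :=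
  2 / (t : ℝ) *
    (Real.sqrt P + 6 * Real.sqrt (Real.log ((3 + (t : ℝ)) * (t : ℝ) ^ 2 / δ))) *
    Real.sqrt (Real.log (8 * (T : ℝ) ^ 2 * (N : ℝ) ^ 2 * Real.log (T : ℝ) / δ))

/-- What the algorithm remembers after `t` rounds. -/
structure State (X Z : Type*) where
  /-- the version space `H_{t+1}` to be used in round `t + 1` -/
  space : Finset (X → Z)
  /-- `h ↦ ∑_{s = 1}^t (Q_s / p_s) ℓ(h(x_s), y_s)` -/
  weightedLoss : (X → Z) → ℝ
  /-- `∑_{s = 1}^t p_s` -/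
  probSum : ℝ

/-- The value of the coin with bias `p` that is flipped by means of a uniform number `u`. -/
def coin (p u : ℝ) : ℝ := if u < p then 1 else 0

open Classical in
/-- Enhanced-IWeS-V run on the examples `e 0, e 1, …` with the uniform numbers `u 0, u 1, …`:
the state after `t` rounds. Rounds are counted from `0` here: `e t` is `(x_{t+1}, y_{t+1})`.
The new version space `H_{t+2}` consists of the `h ∈ H_{t+1}` whose importance weighted empirical
loss over the first `t + 1` examples exceeds the minimum over `H_{t+1}` by at most the slack. -/
def run (T : ℕ) (δ : ℝ) (ℓ : Z → Y → ℝ) (H : Finset (X → Z)) (e : ℕ → X × Y) (u : ℕ → ℝ) :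
    ℕ → State X Z
  | 0 => { space := H, weightedLoss := fun _ => 0, probSum := 0 }
  | t + 1 =>
    let S := run T δ ℓ H e u t
    let p : ℝ := disagreement ℓ S.space (e t)
    let Q : ℝ := coin p (u t)
    let W : (X → Z) → ℝ := fun h => S.weightedLoss h + Q / p * ℓ (h (e t).1) (e t).2
    let P : ℝ := S.probSum + p
    { space := S.space.filter fun h =>
        1 / ((t + 1 : ℕ) : ℝ) * W h ≤
          (⨅ h' : S.space, 1 / ((t + 1 : ℕ) : ℝ) * W (h' : X → Z)) + slack T H.card δ (t + 1) P
      weightedLoss := W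
      probSum := P }

/-- The sampling probability `p_{t+1}` as a random variable. -/
def samplingProb (T : ℕ) (δ : ℝ) (ℓ : Z → Y → ℝ) (H : Finset (X → Z))
    (E : ℕ → Ω → X × Y) (U : ℕ → Ω → ℝ) (t : ℕ) (ω : Ω) : ℝ :=
  disagreement ℓ (run T δ ℓ H (fun s => E s ω) (fun s => U s ω) t).space (E t ω)

/-- The coin `Q_{t+1}` as a random variable. -/
def selected (T : ℕ) (δ : ℝ) (ℓ : Z → Y → ℝ) (H : Finset (X → Z))
    (E : ℕ → Ω → X × Y) (U : ℕ → Ω → ℝ) (t : ℕ) (ω : Ω) : ℝ :=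
  coin (samplingProb T δ ℓ H E U t ω) (U t ω)

/-- `F_t`, the σ-algebra generated by `(x_s, y_s, Q_s)`, `1 ≤ s ≤ t`. -/
@[reducible]
def history [MeasurableSpace X] [MeasurableSpace Y] (T : ℕ) (δ : ℝ) (ℓ : Z → Y → ℝ)
    (H : Finset (X → Z)) (E : ℕ → Ω → X × Y) (U : ℕ → Ω → ℝ) (t : ℕ) : MeasurableSpace Ω :=
  ⨆ s ∈ Finset.range t,
    MeasurableSpace.comap (fun ω => (E s ω, selected T δ ℓ H E U s ω)) inferInstance

/-- The expected sampling rate `∑_{t = 1}^T E[p_t | F_{t-1}]`. -/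
def expectedSamplingRate [MeasurableSpace X] [MeasurableSpace Y] [MeasurableSpace Ω]
    (μ : Measure Ω) (T : ℕ) (δ : ℝ) (ℓ : Z → Y → ℝ) (H : Finset (X → Z))
    (E : ℕ → Ω → X × Y) (U : ℕ → Ω → ℝ) (ω : Ω) : ℝ :=
  ∑ t ∈ Finset.range T, (μ[samplingProb T δ ℓ H E U t | history T δ ℓ H E U t]) ω

end Algorithm

end EIWeS

end

/-! For surviving f, g let d be the difference of their losses on an example with sampling
probability p. Since |d| ≤ p, the weighted difference (Q/p)d has second moment d²/p ≤ p given the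
example. Hence, for 0 < λ ≤ 1/3, the factor exp(λ((Q/p)d - L(f) + L(g)) - λ²p) has mean at most 1
given the past (`coin_mgf_le`, `lintegral_devKernel_le_one`), and the products of these factors form
a supermartingale. The correction involves the observed p_s, so the deviations are controlled by P_t
= ∑ p_s itself, which is the quantity in the slack. Markov's inequality and a union bound over a
grid of λ (`le_of_grid_bounds`) give deviations of at most tΔ_t in all rounds.

On that event h⋆ is never eliminated and every survivor has risk at most L(h⋆) + 2Δ_t. Survivors
therefore lie in the ball of radius 2L(h⋆) + 2Δ_t around h⋆, and the mean disagreement q of the next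
round is at most θ_S(4L(h⋆) + 4Δ_t) (`integral_disagreement_space_le`). By `condExp_samplingProb`
this q is the conditional sampling rate.

As Δ_t contains √P_t, the bound is a recursion. It is closed by P_t ≤ 2∑q_s + log(4T/δ), which comes
from a second supermartingale (`mass_tail`). With Λ = log(T/δ), a rough pass gives P_t ≤ K(L(h⋆)t +
Λ³); inserting this into the recursion gives the claimed rate (`sum_rate_le_of_recursion`). In the
polylogarithmic term θ_S is replaced by its bound N. -/

namespace EIWeS

/-! ### Elementary inequalities -/

section RealInequalities

/-- The cubic remainder is at most (2/9)|y|³ ≤ (2/27)y², and 1/2 + 2/27 < 3/5. What matters later is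
that 3/5 stays below 2/3. -/
theorem exp_le_quadratic {y : ℝ} (hy : |y| ≤ 1 / 3) : Real.exp y ≤ 1 + y + 3 / 5 * y ^ 2 := by
  have h := Real.exp_bound (x := y) (by linarith) (n := 3) (by norm_num)
  have h2 : (∑ m ∈ Finset.range 3, y ^ m / (m.factorial : ℝ)) = 1 + y + y ^ 2 / 2 := by
    simp [Finset.sum_range_succ, Nat.factorial]
  rw [h2] at h
  have h3 := (abs_le.1 h).2
  have h4 : |y| ^ 3 ≤ 1 / 3 * y ^ 2 := by
    rw [pow_succ, sq_abs]; nlinarith [sq_nonneg y]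
  norm_num [Nat.factorial] at h3
  nlinarith [sq_nonneg y]

/-- The moment generating function bound behind the self-normalized deviation inequality. -/
theorem coin_mgf_le {lam p d : ℝ} (hl : 0 < lam) (hl3 : lam ≤ 1 / 3) (hp : 0 ≤ p) (hp1 : p ≤ 1)
    (hd : |d| ≤ p) :
    (p * Real.exp (lam * (1 / p * d)) + (1 - p)) * Real.exp (-(lam ^ 2 * p)) ≤ 1 + lam * d := by
  have hdl := abs_le.1 hd
  have hx0 : 0 ≤ lam ^ 2 * p := by positivity
  have hx1 : lam ^ 2 * p ≤ 1 / 9 := by nlinarith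
  have h1 : p * Real.exp (lam * (1 / p * d)) + (1 - p) ≤ 1 + lam * d + 3 / 5 * (lam ^ 2 * p) := by
    -- At p = 0 the quotient 1/p is 0 by convention and d vanishes, so nothing is lost.
    rcases hp.eq_or_lt with rfl | hp
    · have : d = 0 := by simpa using hd
      simp [this]
    · have hy : |lam * (1 / p * d)| ≤ 1 / 3 := by
        rw [abs_mul, abs_mul, abs_of_pos hl, abs_of_pos (by positivity : 0 < 1 / p)]
        have : 1 / p * |d| ≤ 1 := by rw [one_div, inv_mul_le_iff₀ hp]; linarith
        nlinarith [abs_nonneg d]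
      have h := mul_le_mul_of_nonneg_left (exp_le_quadratic hy) hp.le
      have h2 : p * (1 + lam * (1 / p * d) + 3 / 5 * (lam * (1 / p * d)) ^ 2)
          = p + lam * d + 3 / 5 * (lam ^ 2 * (d ^ 2 / p)) := by
        field_simp
      have h3 : d ^ 2 / p ≤ p := by
        rw [div_le_iff₀ hp]; nlinarith
      nlinarith [mul_le_mul_of_nonneg_left h3 (sq_nonneg lam)]
  have h2 : Real.exp (-(lam ^ 2 * p)) ≤ 1 - lam ^ 2 * p + (lam ^ 2 * p) ^ 2 / 2 := by
    have hq := Real.quadratic_le_exp_of_nonneg hx0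
    rw [Real.exp_neg, inv_le_iff_one_le_mul₀ (Real.exp_pos _)]
    generalize lam ^ 2 * p = x at *
    have : 0 ≤ 1 - x + x ^ 2 / 2 := by nlinarith
    nlinarith [mul_le_mul_of_nonneg_left hq this, pow_nonneg hx0 4]
  have hld : -(1 / 3) ≤ lam * d := by nlinarith
  have h0 : 0 ≤ 1 + lam * d + 3 / 5 * (lam ^ 2 * p) := by linarith
  refine (mul_le_mul h1 h2 (Real.exp_pos _).le h0).trans ?_
  generalize lam ^ 2 * p = x at *
  generalize lam * d = y at *
  -- Because 1 + y ≥ 2/3, the decay factor removes at least (2/3)x, more than the second-order term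
  -- (3/5)x adds.
  have h3 : 0 ≤ x - x ^ 2 / 2 := by nlinarith
  nlinarith [mul_nonneg h3 (by linarith : 0 ≤ y + 1 / 3), mul_nonneg hx0 (mul_nonneg hx0 hx0),
    mul_nonneg hx0 hx0, mul_nonneg hx0 (by linarith : 0 ≤ 1 / 9 - x),
    mul_nonneg (mul_nonneg hx0 hx0) (by linarith : 0 ≤ 1 / 9 - x)]

theorem exp_le_one_add_two_mul {p : ℝ} (hp : 0 ≤ p) (hp1 : p ≤ 1) :
    Real.exp p ≤ 1 + 2 * p := by
  have h := Real.abs_exp_sub_one_sub_id_le (x := p) (by rw [abs_of_nonneg hp]; exact hp1)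
  have := (abs_le.1 h).2
  nlinarith

theorem sum_inv_le {m T : ℕ} (hm : m < T) {Lam : ℝ} (h1 : 1 ≤ Lam) (hT : Real.log T ≤ Lam) :
    ∑ s ∈ Finset.range m, 1 / ((s : ℝ) + 1) ≤ 2 * Lam := by
  have h := harmonic_le_one_add_log m
  have h2 : ((harmonic m : ℚ) : ℝ) = ∑ s ∈ Finset.range m, 1 / ((s : ℝ) + 1) := by
    simp [harmonic]
  rw [h2] at h
  have h3 : Real.log m ≤ Real.log T := by
    rcases Nat.eq_zero_or_pos m with rfl | h0
    · simp; exact Real.log_natCast_nonneg T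
    · exact Real.log_le_log (by exact_mod_cast h0) (by exact_mod_cast hm.le)
  linarith

theorem sum_inv_sqrt_le (m : ℕ) :
    ∑ s ∈ Finset.range m, 1 / Real.sqrt ((s : ℝ) + 1) ≤ 2 * Real.sqrt m := by
  induction m with
  | zero => simp
  | succ m ih =>
    rw [Finset.sum_range_succ]
    push_cast
    have hs : 0 < Real.sqrt ((m : ℝ) + 1) := Real.sqrt_pos.2 (by positivity)
    have h1 := Real.sq_sqrt (by positivity : (0 : ℝ) ≤ (m : ℝ) + 1)
    have h0 := Real.sq_sqrt (by positivity : (0 : ℝ) ≤ (m : ℝ))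
    have : 1 / Real.sqrt ((m : ℝ) + 1) ≤ 2 * Real.sqrt ((m : ℝ) + 1) - 2 * Real.sqrt m := by
      rw [div_le_iff₀ hs]
      nlinarith [sq_nonneg (Real.sqrt ((m : ℝ) + 1) - Real.sqrt m)]
    linarith

end RealInequalities

/-! ### The deterministic recursion for the sampling rate -/

section Recursion

variable {N c θ L Lam b l₀ : ℝ} {T : ℕ} {a P q : ℕ → ℝ}

/-- No slack precedes the first round, which is charged 1. The confidence terms `a` enter with
weight 1/t and cost a harmonic sum. The sum over √P is left untouched because it is estimated twice,
first roughly and then sharply. -/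
theorem sum_rate_le (hc : 1 ≤ c) (hθ : 0 ≤ θ)
    (hLam : 1 ≤ Lam) (hT : Real.log T ≤ Lam) (hbc : b ≤ c * Lam)
    (ha : ∀ t, 1 ≤ t → t < T → a t ≤ c * Lam) (hq0 : q 0 ≤ 1)
    (hq : ∀ t, 1 ≤ t → t < T → q t ≤
      θ * (4 * L + 4 * (2 / (t : ℝ) * (Real.sqrt (P t) + 6 * Real.sqrt (a t)) * Real.sqrt b)))
    {m : ℕ} (hm : m < T) :
    ∑ s ∈ Finset.range (m + 1), q s ≤ 1 + θ * (4 * L * m +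
      8 * Real.sqrt b * ∑ s ∈ Finset.range m, Real.sqrt (P (s + 1)) * (1 / ((s : ℝ) + 1)) +
      96 * c * Lam ^ 2) := by
  rw [Finset.sum_range_succ']
  have hcL : 0 ≤ c * Lam := by nlinarith
  have key : ∀ s ∈ Finset.range m, q (s + 1) ≤
      θ * (4 * L + 8 * Real.sqrt b * (Real.sqrt (P (s + 1)) * (1 / ((s : ℝ) + 1))) +
        48 * (c * Lam) * (1 / ((s : ℝ) + 1))) := by
    intro s hs
    have hs' : s + 1 < T := by have := Finset.mem_range.1 hs; omega
    refine (hq (s + 1) (by omega) hs').trans (mul_le_mul_of_nonneg_left ?_ hθ)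
    have hab : Real.sqrt (a (s + 1)) * Real.sqrt b ≤ c * Lam := by
      calc _ ≤ Real.sqrt (c * Lam) * Real.sqrt (c * Lam) := by
            gcongr
            exact ha _ (by omega) hs'
        _ = _ := Real.mul_self_sqrt hcL
    have hpos : (0 : ℝ) < 1 / ((s : ℝ) + 1) := by positivity
    have : (2 : ℝ) / ((s + 1 : ℕ) : ℝ) = 2 * (1 / ((s : ℝ) + 1)) := by push_cast; ring
    rw [this]
    nlinarith [mul_le_mul_of_nonneg_left hab hpos.le]
  have h1 := Finset.sum_le_sum key
  rw [← Finset.mul_sum, Finset.sum_add_distrib, Finset.sum_add_distrib, Finset.sum_const,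
    Finset.card_range, nsmul_eq_mul, ← Finset.mul_sum, ← Finset.mul_sum] at h1
  have h2 := mul_le_mul_of_nonneg_left (sum_inv_le hm hLam hT) (by positivity : 0 ≤ 48 * (c * Lam))
  have h3 : 4 * L * m +
      8 * Real.sqrt b * ∑ s ∈ Finset.range m, Real.sqrt (P (s + 1)) * (1 / ((s : ℝ) + 1)) +
      48 * (c * Lam) * (2 * Lam) = 4 * L * m +
      8 * Real.sqrt b * ∑ s ∈ Finset.range m, Real.sqrt (P (s + 1)) * (1 / ((s : ℝ) + 1)) +
      96 * c * Lam ^ 2 := by ring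
  have h4 : θ * ((m : ℝ) * (4 * L) +
      8 * Real.sqrt b * ∑ s ∈ Finset.range m, Real.sqrt (P (s + 1)) * (1 / ((s : ℝ) + 1)) +
      48 * (c * Lam) * ∑ s ∈ Finset.range m, 1 / ((s : ℝ) + 1)) ≤ θ * (4 * L * m +
      8 * Real.sqrt b * ∑ s ∈ Finset.range m, Real.sqrt (P (s + 1)) * (1 / ((s : ℝ) + 1)) +
      96 * c * Lam ^ 2) := by
    refine mul_le_mul_of_nonneg_left ?_ hθ
    linarith
  linarith

/-- A rough bound on the sampled mass, polylogarithmic up to the term linear in the risk. -/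
theorem probSum_le_of_recursion (hN : 1 ≤ N) (hc : 1 ≤ c) (hθ : 0 ≤ θ) (hθN : θ ≤ N) (hL : 0 ≤ L)
    (hLam : 1 ≤ Lam) (hT : Real.log T ≤ Lam) (hbc : b ≤ c * Lam) (hl₀ : l₀ ≤ c * Lam)
    (ha : ∀ t, 1 ≤ t → t < T → a t ≤ c * Lam) (hPmono : Monotone P) (hP : ∀ t, 0 ≤ P t)
    (hPq : ∀ t ≤ T, P t ≤ 2 * ∑ s ∈ Finset.range t, q s + l₀) (hq0 : q 0 ≤ 1)
    (hq : ∀ t, 1 ≤ t → t < T → q t ≤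
      θ * (4 * L + 4 * (2 / (t : ℝ) * (Real.sqrt (P t) + 6 * Real.sqrt (a t)) * Real.sqrt b)))
    {m : ℕ} (hm : m < T) :
    P (m + 1) ≤ (16 * N + 4 + 384 * N * c + 2 * c + 1024 * N ^ 2 * c) *
      (L * ((m : ℝ) + 1) + Lam ^ 3) := by
  have h1 := sum_rate_le hc hθ hLam hT hbc ha hq0 hq hm
  have h2 := hPq (m + 1) (by omega)
  set R := Real.sqrt (P (m + 1)) with hR
  have hR0 : 0 ≤ R := Real.sqrt_nonneg _
  have hRR : R ^ 2 = P (m + 1) := Real.sq_sqrt (hP _)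
  -- By monotonicity every √P is replaced by the last one; this loses a logarithm but makes the
  -- inequality quadratic in R.
  have h3 : ∑ s ∈ Finset.range m, Real.sqrt (P (s + 1)) * (1 / ((s : ℝ) + 1)) ≤ R * (2 * Lam) := by
    calc _ ≤ ∑ s ∈ Finset.range m, R * (1 / ((s : ℝ) + 1)) := by
          refine Finset.sum_le_sum fun s hs => ?_
          have : P (s + 1) ≤ P (m + 1) := hPmono (by have := Finset.mem_range.1 hs; omega)
          have h := Real.sqrt_le_sqrt this
          gcongr
      _ = R * ∑ s ∈ Finset.range m, (1 / ((s : ℝ) + 1)) := by rw [Finset.mul_sum]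
      _ ≤ _ := mul_le_mul_of_nonneg_left (sum_inv_le hm hLam hT) hR0
  have hb' : Real.sqrt b ≤ Real.sqrt c * Real.sqrt Lam := by
    rw [← Real.sqrt_mul (by linarith)]; exact Real.sqrt_le_sqrt hbc
  set σ := Real.sqrt c
  set r := Real.sqrt Lam
  have hσ : σ ^ 2 = c := Real.sq_sqrt (by linarith)
  have hr : r ^ 2 = Lam := Real.sq_sqrt (by linarith)
  have hσ0 : 0 ≤ σ := Real.sqrt_nonneg _
  have hr0 : 0 ≤ r := Real.sqrt_nonneg _
  have h4 : 8 * Real.sqrt b *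
      ∑ s ∈ Finset.range m, Real.sqrt (P (s + 1)) * (1 / ((s : ℝ) + 1)) ≤
      16 * σ * r ^ 3 * R := by
    calc _ ≤ 8 * (σ * r) * (R * (2 * Lam)) := by gcongr
      _ = _ := by rw [← hr]; ring
  have hm0 : (0 : ℝ) ≤ m := Nat.cast_nonneg m
  have h5 : θ * (4 * L * m +
      8 * Real.sqrt b * ∑ s ∈ Finset.range m, Real.sqrt (P (s + 1)) * (1 / ((s : ℝ) + 1)) +
      96 * c * Lam ^ 2) ≤ N * (4 * L * m + 16 * σ * r ^ 3 * R + 96 * c * Lam ^ 2) := by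
    refine (mul_le_mul_of_nonneg_left (by gcongr) hθ).trans
      (mul_le_mul_of_nonneg_right hθN (by positivity))
  have hLL : Lam ^ 2 ≤ Lam ^ 3 := pow_le_pow_right₀ hLam (by norm_num)
  have hL1 : Lam ≤ Lam ^ 3 := le_self_pow₀ hLam (by norm_num)
  have hL0 : 1 ≤ Lam ^ 3 := one_le_pow₀ hLam
  have hr6 : (r ^ 3) ^ 2 = Lam ^ 3 := by rw [← hr]; ring
  -- AM-GM lets half of P be absorbed on the left-hand side.
  have h6 : 32 * N * σ * r ^ 3 * R ≤ P (m + 1) / 2 + 512 * N ^ 2 * c * Lam ^ 3 := by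
    rw [← hRR, ← hr6, ← hσ]
    nlinarith [sq_nonneg (R - 32 * N * σ * r ^ 3)]
  have hNc : 0 ≤ N * c := by positivity
  have h7 : N * c * Lam ^ 2 ≤ N * c * Lam ^ 3 := mul_le_mul_of_nonneg_left hLL hNc
  have h8 : c * Lam ≤ c * Lam ^ 3 := mul_le_mul_of_nonneg_left hL1 (by linarith)
  have h9 : P (m + 1) ≤ 16 * N * (L * m) +
      (4 + 384 * N * c + 2 * c + 1024 * N ^ 2 * c) * Lam ^ 3 := by nlinarith
  have hLm : 0 ≤ L * m := by positivity
  have e1 : (16 * N + 4 + 384 * N * c + 2 * c + 1024 * N ^ 2 * c) * (L * ((m : ℝ) + 1) + Lam ^ 3)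
     = (16 * N * (L * m) + (4 + 384 * N * c + 2 * c + 1024 * N ^ 2 * c) * Lam ^ 3) +
      ((16 * N) * (L + Lam ^ 3) + (4 + 384 * N * c + 2 * c + 1024 * N ^ 2 * c) * (L * m + L)) := by
    ring
  rw [e1]
  have : 0 ≤ ((16 * N) * (L + Lam ^ 3) +
      (4 + 384 * N * c + 2 * c + 1024 * N ^ 2 * c) * (L * m + L)) := by positivity
  linarith

/-- Bootstrap: inserting `probSum_le_of_recursion` into √P/t splits it into √L/√t, which sums to
√(LT), and Λ^(3/2)/t, which sums to Λ^(5/2). The factor √b, of order √Λ, turns these into √(LTΛ) and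
Λ³. -/
theorem sum_rate_le_of_recursion (hN : 1 ≤ N) (hc : 1 ≤ c) (hθ : 0 ≤ θ) (hθN : θ ≤ N) (hL : 0 ≤ L)
    (hLam : 1 ≤ Lam) (hT : Real.log T ≤ Lam) (hbc : b ≤ c * Lam) (hl₀ : l₀ ≤ c * Lam)
    (ha : ∀ t, 1 ≤ t → t < T → a t ≤ c * Lam) (hPmono : Monotone P) (hP : ∀ t, 0 ≤ P t)
    (hPq : ∀ t ≤ T, P t ≤ 2 * ∑ s ∈ Finset.range t, q s + l₀) (hq0 : q 0 ≤ 1)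
    (hq : ∀ t, 1 ≤ t → t < T → q t ≤
      θ * (4 * L + 4 * (2 / (t : ℝ) * (Real.sqrt (P t) + 6 * Real.sqrt (a t)) * Real.sqrt b)))
    {K : ℝ} (hK : K = 16 * N + 4 + 384 * N * c + 2 * c + 1024 * N ^ 2 * c) (hT0 : 0 < T) :
    ∑ s ∈ Finset.range T, q s ≤
      θ * (4 * L * T + 16 * Real.sqrt c * Real.sqrt K * Real.sqrt (L * T * Lam)) +
        (1 + N * (16 * Real.sqrt c * Real.sqrt K + 96 * c)) * Lam ^ 3 := by
  obtain ⟨m, rfl⟩ : ∃ m, T = m + 1 := ⟨T - 1, by omega⟩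
  have h1 := sum_rate_le hc hθ hLam hT hbc ha hq0 hq (Nat.lt_succ_self m)
  have hb' : Real.sqrt b ≤ Real.sqrt c * Real.sqrt Lam := by
    rw [← Real.sqrt_mul (by linarith)]; exact Real.sqrt_le_sqrt hbc
  have hK0 : 0 ≤ K := by rw [hK]; positivity
  set σ := Real.sqrt c
  set r := Real.sqrt Lam with hrdef
  have hr : r ^ 2 = Lam := Real.sq_sqrt (by linarith)
  have hσ0 : 0 ≤ σ := Real.sqrt_nonneg _
  have hr0 : 0 ≤ r := Real.sqrt_nonneg _
  have hP' : ∀ s ∈ Finset.range m, Real.sqrt (P (s + 1)) * (1 / ((s : ℝ) + 1)) ≤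
      Real.sqrt K * (Real.sqrt L * (1 / Real.sqrt ((s : ℝ) + 1)) + r ^ 3 * (1 / ((s : ℝ) + 1))) := by
    intro s hs
    have h2 := probSum_le_of_recursion hN hc hθ hθN hL hLam hT hbc hl₀ ha hPmono hP hPq hq0 hq
      (m := s) (by have := Finset.mem_range.1 hs; omega)
    rw [← hK] at h2
    have hs0 : (0 : ℝ) < (s : ℝ) + 1 := by positivity
    have h3 : Real.sqrt (P (s + 1)) ≤
        Real.sqrt K * (Real.sqrt L * Real.sqrt ((s : ℝ) + 1) + r ^ 3) := by
      apply Real.sqrt_le_iff.2 ⟨by positivity, h2.trans ?_⟩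
      rw [mul_pow, Real.sq_sqrt hK0]
      refine mul_le_mul_of_nonneg_left ?_ hK0
      have e1 := Real.sq_sqrt hL
      have e2 := Real.sq_sqrt hs0.le
      have e3 : (r ^ 3) ^ 2 = Lam ^ 3 := by rw [← hr]; ring
      have e4 : 0 ≤ Real.sqrt L * Real.sqrt ((s : ℝ) + 1) * r ^ 3 := by positivity
      calc _ = (Real.sqrt L) ^ 2 * (Real.sqrt ((s : ℝ) + 1)) ^ 2 + (r ^ 3) ^ 2 := by
            rw [e1, e2, e3]
        _ ≤ _ := by nlinarith
    have h4 : Real.sqrt ((s : ℝ) + 1) * (1 / ((s : ℝ) + 1)) = 1 / Real.sqrt ((s : ℝ) + 1) := by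
      have := Real.mul_self_sqrt hs0.le
      have hp := Real.sqrt_pos.2 hs0
      field_simp
      nlinarith
    calc _ ≤ Real.sqrt K * (Real.sqrt L * Real.sqrt ((s : ℝ) + 1) + r ^ 3) *
          (1 / ((s : ℝ) + 1)) := by gcongr
      _ = _ := by rw [← h4]; ring
  have h2 := Finset.sum_le_sum hP'
  rw [← Finset.mul_sum, Finset.sum_add_distrib, ← Finset.mul_sum, ← Finset.mul_sum] at h2
  have h3 : Real.sqrt L * ∑ s ∈ Finset.range m, 1 / Real.sqrt ((s : ℝ) + 1) ≤
      Real.sqrt L * (2 * Real.sqrt ((m + 1 : ℕ) : ℝ)) := by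
    refine mul_le_mul_of_nonneg_left ((sum_inv_sqrt_le m).trans ?_) (Real.sqrt_nonneg _)
    gcongr
    omega
  have h4 := mul_le_mul_of_nonneg_left (sum_inv_le (Nat.lt_succ_self m) hLam hT)
    (by positivity : 0 ≤ r ^ 3)
  have e5 : Real.sqrt (L * ((m + 1 : ℕ) : ℝ) * Lam) =
      Real.sqrt L * Real.sqrt ((m + 1 : ℕ) : ℝ) * r := by
    rw [Real.sqrt_mul (by positivity), Real.sqrt_mul hL]
  have h5 : 8 * Real.sqrt b *
      ∑ s ∈ Finset.range m, Real.sqrt (P (s + 1)) * (1 / ((s : ℝ) + 1)) ≤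
      16 * σ * Real.sqrt K * (Real.sqrt (L * ((m + 1 : ℕ) : ℝ) * Lam) + Lam ^ 3) := by
    calc _ ≤ 8 * (σ * r) * (Real.sqrt K * (Real.sqrt L * (2 * Real.sqrt ((m + 1 : ℕ) : ℝ)) +
          r ^ 3 * (2 * Lam))) := by
          refine mul_le_mul (by linarith) (h2.trans ?_) (Finset.sum_nonneg fun s _ => by positivity)
            (by positivity)
          exact mul_le_mul_of_nonneg_left (by linarith) (Real.sqrt_nonneg _)
      _ = _ := by rw [e5]; simp only [← hr]; ring
  have hLL : Lam ^ 2 ≤ Lam ^ 3 := pow_le_pow_right₀ hLam (by norm_num)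
  have hL0 : 1 ≤ Lam ^ 3 := one_le_pow₀ hLam
  have h6 : 4 * L * (m : ℝ) ≤ 4 * L * ((m + 1 : ℕ) : ℝ) := by
    gcongr
    omega
  generalize Real.sqrt (L * ((m + 1 : ℕ) : ℝ) * Lam) = S at *
  have h7 : θ * (4 * L * m +
      8 * Real.sqrt b * ∑ s ∈ Finset.range m, Real.sqrt (P (s + 1)) * (1 / ((s : ℝ) + 1)) +
      96 * c * Lam ^ 2) ≤ θ * (4 * L * ((m + 1 : ℕ) : ℝ) + 16 * σ * Real.sqrt K * S) +
        θ * ((16 * σ * Real.sqrt K + 96 * c) * Lam ^ 3) := by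
    rw [← mul_add]
    refine mul_le_mul_of_nonneg_left ?_ hθ
    have h9 := mul_le_mul_of_nonneg_left hLL (by linarith : 0 ≤ 96 * c)
    linarith
  -- Only the polylogarithmic part gives up θ for N; the other terms keep the factor θ.
  have h8 : θ * ((16 * σ * Real.sqrt K + 96 * c) * Lam ^ 3) ≤
      N * ((16 * σ * Real.sqrt K + 96 * c) * Lam ^ 3) :=
    mul_le_mul_of_nonneg_right hθN (by positivity)
  have h10 : (1 + N * (16 * σ * Real.sqrt K + 96 * c)) * Lam ^ 3 =
      Lam ^ 3 + N * ((16 * σ * Real.sqrt K + 96 * c) * Lam ^ 3) := by ring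
  linarith

end Recursion

end EIWeS

namespace EIWeS

variable {X Y Z Ω : Type*}

/-! ### Sampling probabilities, and measurability of functions of a random finite set -/

section Disagreement

variable {ℓ : Z → Y → ℝ} {V H : Finset (X → Z)} {e : X × Y}

theorem disagreement_nonneg : 0 ≤ disagreement ℓ V e := by
  rcases V.eq_empty_or_nonempty with rfl | ⟨h, hh⟩
  · exact Real.iSup_nonneg fun fg => absurd fg.1.2 (Finset.notMem_empty _)
  · exact Real.iSup_nonneg' ⟨⟨⟨h, hh⟩, ⟨h, hh⟩⟩, by simp⟩

theorem disagreement_le_one (hℓ : ∀ z y, ℓ z y ∈ Set.Icc (0 : ℝ) 1) : disagreement ℓ V e ≤ 1 := by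
  refine Real.iSup_le (fun fg => ?_) zero_le_one
  have h1 := (hℓ ((fg.1 : X → Z) e.1) e.2).2
  have h2 := (hℓ ((fg.2 : X → Z) e.1) e.2).1
  linarith

theorem abs_sub_le_disagreement {f g : X → Z} (hf : f ∈ V) (hg : g ∈ V) :
    |ℓ (f e.1) e.2 - ℓ (g e.1) e.2| ≤ disagreement ℓ V e := by
  have hb : BddAbove (Set.range fun fg : V × V =>
      (ℓ ((fg.1 : X → Z) e.1) e.2 - ℓ ((fg.2 : X → Z) e.1) e.2)) := (Set.finite_range _).bddAbove
  refine abs_sub_le_iff.2 ⟨le_ciSup hb (⟨f, hf⟩, ⟨g, hg⟩), le_ciSup hb (⟨g, hg⟩, ⟨f, hf⟩)⟩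

variable [MeasurableSpace X] [MeasurableSpace Y]

theorem measurable_disagreement (hm : ∀ h ∈ H, Measurable fun e : X × Y => ℓ (h e.1) e.2)
    (hV : V ⊆ H) : Measurable (disagreement ℓ V) :=
  Measurable.iSup fun fg : V × V => (hm _ (hV fg.1.2)).sub (hm _ (hV fg.2.2))

end Disagreement

theorem measurableSet_finset_eq {A Ω : Type*} {m : MeasurableSpace Ω}
    {S : Ω → Finset A} {H : Finset A} (hS : ∀ ω, S ω ⊆ H)
    (hSm : ∀ h ∈ H, MeasurableSet {ω | h ∈ S ω}) {V : Finset A} (hV : V ⊆ H) :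
    MeasurableSet {ω | S ω = V} := by
  have : {ω | S ω = V} = ⋂ h ∈ H, {ω | h ∈ S ω ↔ h ∈ V} := by
    ext ω
    simp only [Set.mem_ofPred_eq, Set.mem_iInter]
    refine ⟨fun h _ _ => by rw [h], fun h => ?_⟩
    ext x
    by_cases hx : x ∈ H
    · exact h x hx
    · exact ⟨fun h' => absurd (hS ω h') hx, fun h' => absurd (hV h') hx⟩
  rw [this]
  refine MeasurableSet.biInter H.countable_toSet fun h hh => ?_
  exact (hSm h hh).iff (MeasurableSet.const _)

/-- The random version space takes finitely many values, the subsets of H, so it can be frozen at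
each value V and the pieces glued together. -/
theorem measurable_apply_finset {A Ω β : Type*} {m : MeasurableSpace Ω} [MeasurableSpace β]
    {S : Ω → Finset A} {H : Finset A} (hS : ∀ ω, S ω ⊆ H)
    (hSm : ∀ h ∈ H, MeasurableSet {ω | h ∈ S ω}) {f : Finset A → Ω → β}
    (hf : ∀ V ⊆ H, Measurable (f V)) : Measurable fun ω => f (S ω) ω := by
  intro s hs
  have : (fun ω => f (S ω) ω) ⁻¹' s = ⋃ V ∈ H.powerset, {ω | S ω = V} ∩ f V ⁻¹' s := by
    ext ω
    simp only [Set.mem_preimage, Set.mem_iUnion, Set.mem_inter_iff, Set.mem_ofPred_eq,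
      Finset.mem_powerset, exists_prop]
    exact ⟨fun h => ⟨S ω, hS ω, rfl, h⟩, fun ⟨V, _, h, h'⟩ => by rw [h]; exact h'⟩
  rw [this]
  refine MeasurableSet.biUnion H.powerset.countable_toSet fun V h => ?_
  have h := Finset.mem_powerset.1 h
  exact (measurableSet_finset_eq hS hSm h).inter (hf V h hs)

/-! ### The state of the algorithm -/

section State

/-- The state after `t` rounds as a random variable. -/
noncomputable def state (T : ℕ) (δ : ℝ) (ℓ : Z → Y → ℝ) (H : Finset (X → Z))
    (E : ℕ → Ω → X × Y) (U : ℕ → Ω → ℝ) (t : ℕ) (ω : Ω) : State X Z :=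
  run T δ ℓ H (fun s => E s ω) (fun s => U s ω) t

variable {T : ℕ} {δ : ℝ} {ℓ : Z → Y → ℝ} {H : Finset (X → Z)}
  {E : ℕ → Ω → X × Y} {U : ℕ → Ω → ℝ} {t : ℕ} {ω : Ω} {h : X → Z}

theorem state_weightedLoss_succ : (state T δ ℓ H E U (t + 1) ω).weightedLoss h =
    (state T δ ℓ H E U t ω).weightedLoss h +
      selected T δ ℓ H E U t ω / samplingProb T δ ℓ H E U t ω * ℓ (h (E t ω).1) (E t ω).2 := rfl

theorem state_probSum_succ : (state T δ ℓ H E U (t + 1) ω).probSum =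
    (state T δ ℓ H E U t ω).probSum + samplingProb T δ ℓ H E U t ω := rfl

theorem samplingProb_eq : samplingProb T δ ℓ H E U t ω =
    disagreement ℓ (state T δ ℓ H E U t ω).space (E t ω) := rfl

theorem mem_state_space_succ : h ∈ (state T δ ℓ H E U (t + 1) ω).space ↔
    h ∈ (state T δ ℓ H E U t ω).space ∧
    1 / ((t + 1 : ℕ) : ℝ) * (state T δ ℓ H E U (t + 1) ω).weightedLoss h ≤
      (⨅ h' : (state T δ ℓ H E U t ω).space,
        1 / ((t + 1 : ℕ) : ℝ) * (state T δ ℓ H E U (t + 1) ω).weightedLoss (h' : X → Z)) +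
      slack T H.card δ (t + 1) (state T δ ℓ H E U (t + 1) ω).probSum := by
  classical
  exact Finset.mem_filter

theorem state_space_succ_subset :
    (state T δ ℓ H E U (t + 1) ω).space ⊆ (state T δ ℓ H E U t ω).space := fun _ hh =>
  (mem_state_space_succ.1 hh).1

theorem state_space_antitone : Antitone fun t => (state T δ ℓ H E U t ω).space :=
  antitone_nat_of_succ_le fun _ => state_space_succ_subset

theorem state_space_subset : (state T δ ℓ H E U t ω).space ⊆ H :=
  state_space_antitone (Nat.zero_le t)

theorem state_probSum : (state T δ ℓ H E U t ω).probSum =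
    ∑ s ∈ Finset.range t, samplingProb T δ ℓ H E U s ω := by
  induction t with
  | zero => rfl
  | succ t ih => rw [state_probSum_succ, ih, Finset.sum_range_succ]

end State

/-! ### Measurability of the run and the two filtrations -/

section Measurability

variable [MeasurableSpace X] [MeasurableSpace Y]

theorem measurable_slack (T N : ℕ) (δ : ℝ) (t : ℕ) : Measurable (slack T N δ t) := by
  unfold slack
  fun_prop

theorem measurable_coin : Measurable fun pu : ℝ × ℝ => coin pu.1 pu.2 :=
  Measurable.ite (measurableSet_lt measurable_snd measurable_fst) measurable_const measurable_const

variable {T : ℕ} {δ : ℝ} {ℓ : Z → Y → ℝ} {H : Finset (X → Z)}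
  {E : ℕ → Ω → X × Y} {U : ℕ → Ω → ℝ} {t n : ℕ} {m : MeasurableSpace Ω}

theorem measurable_samplingProb (hm : ∀ h ∈ H, Measurable fun e : X × Y => ℓ (h e.1) e.2)
    (hS : ∀ h ∈ H, MeasurableSet {ω | h ∈ (state T δ ℓ H E U t ω).space})
    (hE : Measurable (E t)) : Measurable (samplingProb T δ ℓ H E U t) :=
  measurable_apply_finset (S := fun ω => (state T δ ℓ H E U t ω).space)
    (f := fun V ω => disagreement ℓ V (E t ω)) (fun _ => state_space_subset) hS
    fun _ hV => (measurable_disagreement hm hV).comp hE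

/-- The hypotheses involve the coins, not the uniform numbers, and the σ-algebra on Ω is arbitrary.
Thus the result serves for `history`, which records only the coins, as well as for `pastAlgebra`. -/
theorem measurable_state (hm : ∀ h ∈ H, Measurable fun e : X × Y => ℓ (h e.1) e.2)
    (hE : ∀ s < n, Measurable (E s)) (hQ : ∀ s < n, Measurable (selected T δ ℓ H E U s)) :
    ∀ t ≤ n, (∀ h ∈ H, MeasurableSet {ω | h ∈ (state T δ ℓ H E U t ω).space}) ∧
      (∀ h ∈ H, Measurable fun ω => (state T δ ℓ H E U t ω).weightedLoss h) ∧
      Measurable fun ω => (state T δ ℓ H E U t ω).probSum := by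
  intro t
  induction t with
  | zero =>
    intro _
    exact ⟨fun h _ => MeasurableSet.const (h ∈ H), fun _ _ => measurable_const, measurable_const⟩
  | succ t ih =>
    intro ht
    obtain ⟨hS, hW, hP⟩ := ih (by omega)
    have hp := measurable_samplingProb hm hS (hE t ht)
    have hW' : ∀ h ∈ H, Measurable fun ω => (state T δ ℓ H E U (t + 1) ω).weightedLoss h := by
      intro h hh
      simp only [state_weightedLoss_succ]
      exact (hW h hh).add (((hQ t ht).div hp).mul ((hm h hh).comp (hE t ht)))
    have hP' : Measurable fun ω => (state T δ ℓ H E U (t + 1) ω).probSum := by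
      simp only [state_probSum_succ]
      exact hP.add hp
    refine ⟨fun h hh => ?_, hW', hP'⟩
    simp only [mem_state_space_succ]
    refine (hS h hh).inter (measurableSet_le ((hW' h hh).const_mul _) (Measurable.add ?_
      ((measurable_slack _ _ _ _).comp hP')))
    exact measurable_apply_finset (S := fun ω => (state T δ ℓ H E U t ω).space)
      (f := fun V ω => ⨅ h' : V,
        1 / ((t + 1 : ℕ) : ℝ) * (state T δ ℓ H E U (t + 1) ω).weightedLoss (h' : X → Z))
      (fun _ => state_space_subset) hS
      fun V hV => Measurable.iInf fun h' => (hW' _ (hV h'.2)).const_mul _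

theorem measurable_selected (hm : ∀ h ∈ H, Measurable fun e : X × Y => ℓ (h e.1) e.2)
    (hE : ∀ s < n, Measurable (E s)) (hU : ∀ s < n, Measurable (U s)) :
    ∀ t < n, Measurable (selected T δ ℓ H E U t) := by
  intro t
  induction t using Nat.strong_induction_on with
  | _ t ih =>
    intro ht
    have h := measurable_state (n := t) hm (fun s hs => hE s (hs.trans ht))
      (fun s hs => ih s hs (hs.trans ht)) t le_rfl
    exact measurable_coin.comp ((measurable_samplingProb hm h.1 (hE t ht)).prodMk (hU t ht))

/-- The σ-algebra generated by the examples and the uniform numbers of the first `t` rounds. -/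
@[reducible]
def pastAlgebra (E : ℕ → Ω → X × Y) (U : ℕ → Ω → ℝ) (t : ℕ) : MeasurableSpace Ω :=
  ⨆ s ∈ Set.Iio t, MeasurableSpace.comap (fun ω => (E s ω, U s ω)) inferInstance

theorem measurable_pastAlgebra_pair {s : ℕ} (hs : s < t) :
    Measurable[pastAlgebra E U t] fun ω => (E s ω, U s ω) :=
  Measurable.of_comap_le (le_iSup₂_of_le s hs le_rfl)

theorem measurable_pastAlgebra_selected
    (hm : ∀ h ∈ H, Measurable fun e : X × Y => ℓ (h e.1) e.2) {s : ℕ} (hs : s < t) :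
    Measurable[pastAlgebra E U t] (selected T δ ℓ H E U s) :=
  measurable_selected (m := pastAlgebra E U t) hm
    (fun _ hs => measurable_fst.comp (measurable_pastAlgebra_pair hs))
    (fun _ hs => measurable_snd.comp (measurable_pastAlgebra_pair hs)) s hs

theorem measurableSet_pastAlgebra_mem_space
    (hm : ∀ h ∈ H, Measurable fun e : X × Y => ℓ (h e.1) e.2) {s : ℕ} (hs : s ≤ t) :
    ∀ h ∈ H, MeasurableSet[pastAlgebra E U t] {ω | h ∈ (state T δ ℓ H E U s ω).space} :=
  (measurable_state (m := pastAlgebra E U t) hm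
    (fun _ hs => measurable_fst.comp (measurable_pastAlgebra_pair hs))
    (fun _ hs => measurable_pastAlgebra_selected hm hs) s hs).1

theorem pastAlgebra_le (hE : ∀ t, Measurable (E t)) (hU : ∀ t, Measurable (U t)) :
    pastAlgebra E U t ≤ m :=
  iSup₂_le fun s _ => ((hE s).prodMk (hU s)).comap_le

/-- Transfers to `history` the independence of the next round from `pastAlgebra`. -/
theorem history_le_pastAlgebra (hm : ∀ h ∈ H, Measurable fun e : X × Y => ℓ (h e.1) e.2) :
    history T δ ℓ H E U t ≤ pastAlgebra E U t := by
  refine iSup₂_le fun s hs => ?_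
  have hs := Finset.mem_range.1 hs
  exact Measurable.comap_le (Measurable.prodMk
    (measurable_fst.comp (measurable_pastAlgebra_pair hs)) (measurable_pastAlgebra_selected hm hs))

theorem measurableSet_history_mem_space
    (hm : ∀ h ∈ H, Measurable fun e : X × Y => ℓ (h e.1) e.2) :
    ∀ h ∈ H, MeasurableSet[history T δ ℓ H E U t] {ω | h ∈ (state T δ ℓ H E U t ω).space} := by
  have h : ∀ s < t, Measurable[history T δ ℓ H E U t]
      fun ω => (E s ω, selected T δ ℓ H E U s ω) := fun s hs =>
    Measurable.of_comap_le (le_iSup₂_of_le s (Finset.mem_range.2 hs) le_rfl)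
  exact (measurable_state (m := history T δ ℓ H E U t) hm
    (fun _ hs => measurable_fst.comp (h _ hs))
    (fun _ hs => measurable_snd.comp (h _ hs)) t le_rfl).1

end Measurability

end EIWeS

namespace EIWeS

open scoped ENNReal

/-! ### Exponential supermartingales and conditional sampling rates -/

section Supermartingale

variable {X Y Z Ω : Type*} [MeasurableSpace X] [MeasurableSpace Y] {mΩ : MeasurableSpace Ω}
  {D : Measure (X × Y)} {μ : Measure Ω}
  {T : ℕ} {δ : ℝ} {ℓ : Z → Y → ℝ} {H : Finset (X → Z)} {E : ℕ → Ω → X × Y} {U : ℕ → Ω → ℝ}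

theorem indep_pastAlgebra (hE : ∀ t, Measurable (E t)) (hU : ∀ t, Measurable (U t))
    (hind : iIndepFun (fun t ω => (E t ω, U t ω)) μ) (t : ℕ) :
    Indep (pastAlgebra E U t) (MeasurableSpace.comap (fun ω => (E t ω, U t ω)) inferInstance) μ := by
  have h := indep_iSup_of_disjoint (fun i => ((hE i).prodMk (hU i)).comap_le) hind
    (S := Set.Iio t) (T := {t}) (by simp)
  simp only [Set.mem_singleton_iff, iSup_iSup_eq_left] at h
  exact h

/-- The process `∏ K(V_s, ξ_s)` is a supermartingale if each `K(V, ·)` has mean at most one. -/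
theorem lintegral_prod_le_one [IsProbabilityMeasure μ] (hE : ∀ t, Measurable (E t)) (hU : ∀ t, Measurable (U t))
    (hind : iIndepFun (fun t ω => (E t ω, U t ω)) μ)
    (hmap : ∀ t, Measure.map (fun ω => (E t ω, U t ω)) μ =
      D.prod (volume.restrict (Set.Icc (0 : ℝ) 1)))
    (hm : ∀ h ∈ H, Measurable fun e : X × Y => ℓ (h e.1) e.2)
    {K : Finset (X → Z) → (X × Y) × ℝ → ℝ≥0∞} (hKm : ∀ V ⊆ H, Measurable (K V))
    (hK : ∀ V ⊆ H, ∫⁻ x, K V x ∂(D.prod (volume.restrict (Set.Icc (0 : ℝ) 1))) ≤ 1) (t : ℕ) :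
    Measurable (fun ω => ∏ s ∈ Finset.range t, K (state T δ ℓ H E U s ω).space (E s ω, U s ω)) ∧
    ∫⁻ ω, ∏ s ∈ Finset.range t, K (state T δ ℓ H E U s ω).space (E s ω, U s ω) ∂μ ≤ 1 := by
  classical
  have hle : ∀ t, pastAlgebra E U t ≤ mΩ := fun t => pastAlgebra_le hE hU
  have hpast : ∀ t, Measurable[pastAlgebra E U t]
      (fun ω => ∏ s ∈ Finset.range t, K (state T δ ℓ H E U s ω).space (E s ω, U s ω)) := by
    intro t
    refine Finset.measurable_prod _ fun s hs => ?_
    have hs := Finset.mem_range.1 hs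
    exact measurable_apply_finset (S := fun ω => (state T δ ℓ H E U s ω).space)
      (f := fun V ω => K V (E s ω, U s ω)) (fun _ => state_space_subset)
      (measurableSet_pastAlgebra_mem_space hm hs.le)
      fun V hV => (hKm V hV).comp (measurable_pastAlgebra_pair hs)
  refine ⟨(hpast t).mono (hle t) le_rfl, ?_⟩
  induction t with
  | zero => simp
  | succ t ih =>
    set A : Ω → ℝ≥0∞ := fun ω =>
      ∏ s ∈ Finset.range t, K (state T δ ℓ H E U s ω).space (E s ω, U s ω) with hA
    -- On the event that the current space is V the new factor is K V at the fresh pair, a fixed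
    -- function independent of the past. Splitting over V thus replaces a conditional expectation by
    -- finitely many product formulas.
    have hAV : ∀ V, Measurable[pastAlgebra E U t]
        fun ω => if (state T δ ℓ H E U t ω).space = V then A ω else 0 := by
      intro V
      exact measurable_apply_finset (S := fun ω => (state T δ ℓ H E U t ω).space)
        (f := fun V' ω => if V' = V then A ω else 0) (fun _ => state_space_subset)
        (measurableSet_pastAlgebra_mem_space hm le_rfl)
        fun V' _ => by
          by_cases h : V' = V
          · simpa [h] using hpast t
          · simp [h]
    have hdec : ∀ ω, ∑ V ∈ H.powerset,
        (if (state T δ ℓ H E U t ω).space = V then A ω else 0) = A ω := by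
      intro ω
      rw [Finset.sum_ite_eq, if_pos (Finset.mem_powerset.2 state_space_subset)]
    have hξ : ∀ V ⊆ H, ∫⁻ ω, K V (E t ω, U t ω) ∂μ ≤ 1 := by
      intro V hV
      have := hK V hV
      rwa [← hmap t, lintegral_map (hKm V hV) ((hE t).prodMk (hU t))] at this
    calc ∫⁻ ω, ∏ s ∈ Finset.range (t + 1), K (state T δ ℓ H E U s ω).space (E s ω, U s ω) ∂μ
        = ∫⁻ ω, ∑ V ∈ H.powerset, (if (state T δ ℓ H E U t ω).space = V then A ω else 0) *
            K V (E t ω, U t ω) ∂μ := by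
          refine lintegral_congr fun ω => ?_
          rw [Finset.prod_range_succ]
          simp only [ite_mul, zero_mul]
          rw [Finset.sum_ite_eq, if_pos (Finset.mem_powerset.2 state_space_subset)]
      _ = ∑ V ∈ H.powerset, ∫⁻ ω, (if (state T δ ℓ H E U t ω).space = V then A ω else 0) *
            K V (E t ω, U t ω) ∂μ := by
          refine lintegral_finsetSum _ fun V hV => ?_
          exact ((hAV V).mono (hle t) le_rfl).mul
            ((hKm V (Finset.mem_powerset.1 hV)).comp ((hE t).prodMk (hU t)))
      _ ≤ ∑ V ∈ H.powerset, ∫⁻ ω, (if (state T δ ℓ H E U t ω).space = V then A ω else 0) ∂μ := by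
          refine Finset.sum_le_sum fun V hV => ?_
          have hV := Finset.mem_powerset.1 hV
          have h := lintegral_mul_eq_lintegral_mul_lintegral_of_independent_measurableSpace (hle t)
            (((hE t).prodMk (hU t)).comap_le) (indep_pastAlgebra hE hU hind t) (hAV V)
            ((hKm V hV).comp (comap_measurable _))
          exact h.trans_le (mul_le_of_le_one_right' (hξ V hV))
      _ = ∫⁻ ω, A ω ∂μ := by
          rw [← lintegral_finsetSum _ fun V _ => (hAV V).mono (hle t) le_rfl]
          exact lintegral_congr hdec
      _ ≤ 1 := ih

theorem measure_le_exp_neg {f : Ω → ℝ≥0∞} (hf : Measurable f) (h1 : ∫⁻ ω, f ω ∂μ ≤ 1) {L : ℝ}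
    {B : Set Ω} (hB : ∀ ω ∈ B, ENNReal.ofReal (Real.exp L) ≤ f ω) :
    μ B ≤ ENNReal.ofReal (Real.exp (-L)) := by
  have h0 : 0 < Real.exp L := Real.exp_pos L
  calc μ B ≤ μ {ω | ENNReal.ofReal (Real.exp L) ≤ f ω} := measure_mono hB
    _ ≤ (∫⁻ ω, f ω ∂μ) / ENNReal.ofReal (Real.exp L) :=
        meas_ge_le_lintegral_div hf.aemeasurable (by simpa using h0) ENNReal.ofReal_ne_top
    _ ≤ 1 / ENNReal.ofReal (Real.exp L) := by gcongr
    _ = _ := by rw [Real.exp_neg, ENNReal.ofReal_inv_of_pos h0, one_div]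

theorem lintegral_coin {p : ℝ} (hp : 0 ≤ p) (hp1 : p ≤ 1) {F : ℝ → ℝ} (hF : ∀ x, 0 ≤ F x) :
    ∫⁻ u in Set.Icc (0 : ℝ) 1, ENNReal.ofReal (F (coin p u)) =
      ENNReal.ofReal (p * F 1 + (1 - p) * F 0) := by
  have h : ∀ u, ENNReal.ofReal (F (coin p u)) =
      (Set.Iio p).indicator (fun _ => ENNReal.ofReal (F 1)) u +
        (Set.Ici p).indicator (fun _ => ENNReal.ofReal (F 0)) u := by
    intro u
    by_cases hu : u < p
    · simp [coin, hu, Set.indicator, not_le.2 hu]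
    · simp [coin, hu, Set.indicator, not_lt.1 hu]
  simp only [h]
  rw [lintegral_add_left (measurable_const.indicator measurableSet_Iio),
    lintegral_indicator_const measurableSet_Iio, lintegral_indicator_const measurableSet_Ici,
    Measure.restrict_apply measurableSet_Iio, Measure.restrict_apply measurableSet_Ici]
  have h1 : Set.Iio p ∩ Set.Icc 0 1 = Set.Ico 0 p := by
    ext x; simp only [Set.mem_inter_iff, Set.mem_Iio, Set.mem_Icc, Set.mem_Ico]
    constructor
    · rintro ⟨a, b, _⟩; exact ⟨b, a⟩
    · rintro ⟨a, b⟩; exact ⟨b, a, by linarith⟩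
  have h2 : Set.Ici p ∩ Set.Icc 0 1 = Set.Icc p 1 := by
    ext x; simp only [Set.mem_inter_iff, Set.mem_Ici, Set.mem_Icc]
    constructor
    · rintro ⟨a, _, b⟩; exact ⟨a, b⟩
    · rintro ⟨a, b⟩; exact ⟨a, by linarith, b⟩
  rw [h1, h2, Real.volume_Ico, Real.volume_Icc, ← ENNReal.ofReal_mul (hF 1),
    ← ENNReal.ofReal_mul (hF 0), ← ENNReal.ofReal_add]
  · congr 1; ring
  · exact mul_nonneg (hF 1) (by linarith)
  · exact mul_nonneg (hF 0) (by linarith)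

open Classical in
/-- One factor of the exponential supermartingale that controls the importance weighted estimate of
the difference between the losses of `f` and `g`. -/
noncomputable def devKernel (D : Measure (X × Y)) (ℓ : Z → Y → ℝ) (f g : X → Z) (lam : ℝ)
    (V : Finset (X → Z)) (x : (X × Y) × ℝ) : ℝ≥0∞ :=
  if f ∈ V ∧ g ∈ V then ENNReal.ofReal (Real.exp (lam * (coin (disagreement ℓ V x.1) x.2 /
    disagreement ℓ V x.1 * (ℓ (f x.1.1) x.1.2 - ℓ (g x.1.1) x.1.2) -
      (risk D ℓ f - risk D ℓ g)) - lam ^ 2 * disagreement ℓ V x.1)) else 0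

theorem measurable_devKernel (hm : ∀ h ∈ H, Measurable fun e : X × Y => ℓ (h e.1) e.2)
    {V : Finset (X → Z)} (hV : V ⊆ H) (f g : X → Z) (lam : ℝ) :
    Measurable (devKernel D ℓ f g lam V) := by
  unfold devKernel
  by_cases h : f ∈ V ∧ g ∈ V
  · simp only [h, and_self, if_true]
    have hf := (hm f (hV h.1)).comp (measurable_fst : Measurable fun x : (X × Y) × ℝ => x.1)
    have hg := (hm g (hV h.2)).comp (measurable_fst : Measurable fun x : (X × Y) × ℝ => x.1)
    have hd := (measurable_disagreement hm hV).comp (measurable_fst : Measurable fun x : (X × Y) × ℝ => x.1)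
    have hc := measurable_coin.comp (hd.prodMk (measurable_snd : Measurable fun x : (X × Y) × ℝ => x.2))
    exact (Real.measurable_exp.comp (((((hc.div hd).mul (hf.sub hg)).sub_const _).const_mul _).sub
      (hd.const_mul _))).ennreal_ofReal
  · simp only [h, if_false]
    exact measurable_const

theorem integrable_loss [IsProbabilityMeasure D] (hℓ : ∀ z y, ℓ z y ∈ Set.Icc (0 : ℝ) 1) {h : X → Z}
    (hh : Measurable fun e : X × Y => ℓ (h e.1) e.2) :
    Integrable (fun e : X × Y => ℓ (h e.1) e.2) D :=
  Integrable.of_bound hh.aestronglyMeasurable 1 (ae_of_all _ fun e => by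
    rw [Real.norm_eq_abs, abs_of_nonneg (hℓ _ _).1]; exact (hℓ _ _).2)

theorem integrable_disagreement [IsProbabilityMeasure D] (hℓ : ∀ z y, ℓ z y ∈ Set.Icc (0 : ℝ) 1)
    (hm : ∀ h ∈ H, Measurable fun e : X × Y => ℓ (h e.1) e.2) {V : Finset (X → Z)} (hV : V ⊆ H) :
    Integrable (disagreement ℓ V) D :=
  Integrable.of_bound (measurable_disagreement hm hV).aestronglyMeasurable 1 (ae_of_all _ fun e => by
    rw [Real.norm_eq_abs, abs_of_nonneg disagreement_nonneg]; exact disagreement_le_one hℓ)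

/-- Averaging over the coin first leaves 1 + λd by `coin_mgf_le`. This is linear in d, so averaging
over the example gives 1 + λm ≤ exp(λm), with m the risk difference. The kernel vanishes once f or g
has left V, where |d| ≤ p may fail. -/
theorem lintegral_devKernel_le_one [IsProbabilityMeasure D] (hℓ : ∀ z y, ℓ z y ∈ Set.Icc (0 : ℝ) 1)
    (hm : ∀ h ∈ H, Measurable fun e : X × Y => ℓ (h e.1) e.2)
    {V : Finset (X → Z)} (hV : V ⊆ H) {f g : X → Z} {lam : ℝ} (hl : 0 < lam) (hl3 : lam ≤ 1 / 3) :
    ∫⁻ x, devKernel D ℓ f g lam V x ∂(D.prod (volume.restrict (Set.Icc (0 : ℝ) 1))) ≤ 1 := by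
  rw [lintegral_prod _ (measurable_devKernel hm hV f g lam).aemeasurable]
  by_cases h : f ∈ V ∧ g ∈ V
  swap
  · simp [devKernel, h]
  simp only [devKernel, h, and_self, if_true]
  set m := risk D ℓ f - risk D ℓ g with hmdef
  have hif := integrable_loss (D := D) hℓ (hm f (hV h.1))
  have hig := integrable_loss (D := D) hℓ (hm g (hV h.2))
  have hfg : Integrable (fun e : X × Y => ℓ (f e.1) e.2 - ℓ (g e.1) e.2) D := hif.sub hig
  have hd : ∀ e : X × Y, |ℓ (f e.1) e.2 - ℓ (g e.1) e.2| ≤ 1 := fun e =>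
    (abs_sub_le_disagreement h.1 h.2).trans (disagreement_le_one hℓ)
  calc _ ≤ ∫⁻ e, ENNReal.ofReal ((1 + lam * (ℓ (f e.1) e.2 - ℓ (g e.1) e.2)) *
          Real.exp (-(lam * m))) ∂D := by
        refine lintegral_mono fun e => ?_
        have hp := disagreement_nonneg (ℓ := ℓ) (V := V) (e := e)
        have hp1 := disagreement_le_one (V := V) (e := e) hℓ
        rw [lintegral_coin hp hp1 (F := fun c => Real.exp (lam * (c / disagreement ℓ V e *
          (ℓ (f e.1) e.2 - ℓ (g e.1) e.2) - m) - lam ^ 2 * disagreement ℓ V e))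
          fun _ => (Real.exp_pos _).le]
        refine ENNReal.ofReal_le_ofReal ?_
        refine le_trans (le_of_eq ?_) (mul_le_mul_of_nonneg_right
          (coin_mgf_le hl hl3 hp hp1 (abs_sub_le_disagreement h.1 h.2)) (Real.exp_pos _).le)
        generalize disagreement ℓ V e = p
        generalize ℓ (f e.1) e.2 - ℓ (g e.1) e.2 = d
        have e1 : Real.exp (lam * (1 / p * d - m) - lam ^ 2 * p) =
            Real.exp (lam * (1 / p * d)) * Real.exp (-(lam ^ 2 * p)) * Real.exp (-(lam * m)) := by
          rw [← Real.exp_add, ← Real.exp_add]; ring_nf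
        have e2 : Real.exp (lam * (0 / p * d - m) - lam ^ 2 * p) =
            Real.exp (-(lam ^ 2 * p)) * Real.exp (-(lam * m)) := by
          rw [← Real.exp_add]; ring_nf
        simp only [e1, e2]
        ring
    _ = ENNReal.ofReal (∫ e, (1 + lam * (ℓ (f e.1) e.2 - ℓ (g e.1) e.2)) *
          Real.exp (-(lam * m)) ∂D) := by
        rw [ofReal_integral_eq_lintegral_ofReal]
        · exact ((integrable_const 1).add (hfg.const_mul lam)).mul_const _
        · refine ae_of_all _ fun e => mul_nonneg ?_ (Real.exp_pos _).le
          have := abs_le.1 (hd e)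
          nlinarith
    _ ≤ 1 := by
        rw [ENNReal.ofReal_le_one, integral_mul_const, integral_add (integrable_const 1)
          (hfg.const_mul lam), integral_const_mul, integral_sub hif hig]
        have h1 := Real.add_one_le_exp (lam * m)
        have h2 : Real.exp (lam * m) * Real.exp (-(lam * m)) = 1 := by
          rw [← Real.exp_add]; simp
        have h3 : (∫ e, ℓ (f e.1) e.2 ∂D) - ∫ e, ℓ (g e.1) e.2 ∂D = m := rfl
        simp only [h3, integral_const, probReal_univ, smul_eq_mul, mul_one]
        calc _ ≤ Real.exp (lam * m) * Real.exp (-(lam * m)) := by gcongr; linarith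
          _ = 1 := h2

theorem prod_devKernel {f g : X → Z} {lam : ℝ} {t : ℕ} {ω : Ω}
    (h : ∀ s < t, f ∈ (state T δ ℓ H E U s ω).space ∧ g ∈ (state T δ ℓ H E U s ω).space) :
    ∏ s ∈ Finset.range t, devKernel D ℓ f g lam (state T δ ℓ H E U s ω).space (E s ω, U s ω) =
      ENNReal.ofReal (Real.exp (lam * ((state T δ ℓ H E U t ω).weightedLoss f -
        (state T δ ℓ H E U t ω).weightedLoss g - t * (risk D ℓ f - risk D ℓ g)) -
          lam ^ 2 * (state T δ ℓ H E U t ω).probSum)) := by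
  induction t with
  | zero => simp [state, run]
  | succ t ih =>
    rw [Finset.prod_range_succ, ih fun s hs => h s (by omega), devKernel, if_pos (h t (by omega)),
      ← ENNReal.ofReal_mul (Real.exp_pos _).le, ← Real.exp_add, state_weightedLoss_succ,
      state_weightedLoss_succ, state_probSum_succ, selected, samplingProb_eq]
    congr 2
    push_cast
    ring

theorem deviation_tail [IsProbabilityMeasure D] [IsProbabilityMeasure μ]
    (hℓ : ∀ z y, ℓ z y ∈ Set.Icc (0 : ℝ) 1)
    (hE : ∀ t, Measurable (E t)) (hU : ∀ t, Measurable (U t))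
    (hind : iIndepFun (fun t ω => (E t ω, U t ω)) μ)
    (hmap : ∀ t, Measure.map (fun ω => (E t ω, U t ω)) μ =
      D.prod (volume.restrict (Set.Icc (0 : ℝ) 1)))
    (hm : ∀ h ∈ H, Measurable fun e : X × Y => ℓ (h e.1) e.2)
    (f g : X → Z) {lam : ℝ} (hl : 0 < lam) (hl3 : lam ≤ 1 / 3) (t : ℕ) (L : ℝ) :
    μ {ω | f ∈ (state T δ ℓ H E U t ω).space ∧ g ∈ (state T δ ℓ H E U t ω).space ∧
      L ≤ lam * ((state T δ ℓ H E U (t + 1) ω).weightedLoss f -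
        (state T δ ℓ H E U (t + 1) ω).weightedLoss g -
          ((t + 1 : ℕ) : ℝ) * (risk D ℓ f - risk D ℓ g)) -
          lam ^ 2 * (state T δ ℓ H E U (t + 1) ω).probSum} ≤ ENNReal.ofReal (Real.exp (-L)) := by
  obtain ⟨h1, h2⟩ := lintegral_prod_le_one (T := T) (δ := δ) hE hU hind hmap hm
    (K := devKernel D ℓ f g lam) (fun V hV => measurable_devKernel hm hV f g lam)
    (fun V hV => lintegral_devKernel_le_one hℓ hm hV hl hl3) (t + 1)
  refine measure_le_exp_neg h1 h2 ?_
  rintro ω ⟨hf, hg, hL⟩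
  -- Membership at round t suffices: the spaces decrease, so no earlier factor is zero.
  rw [prod_devKernel fun s hs => ⟨state_space_antitone (Nat.lt_succ_iff.1 hs) hf,
    state_space_antitone (Nat.lt_succ_iff.1 hs) hg⟩]
  exact ENNReal.ofReal_le_ofReal (Real.exp_le_exp.2 hL)

/-- With I the mean of p, exp(p) ≤ 1 + 2p on [0,1] and 1 + 2I ≤ exp(2I) show that exp(p - 2I) has
mean at most 1. The factor 2 makes a variance term unnecessary. -/
theorem mass_tail [IsProbabilityMeasure D] [IsProbabilityMeasure μ]
    (hℓ : ∀ z y, ℓ z y ∈ Set.Icc (0 : ℝ) 1)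
    (hE : ∀ t, Measurable (E t)) (hU : ∀ t, Measurable (U t))
    (hind : iIndepFun (fun t ω => (E t ω, U t ω)) μ)
    (hmap : ∀ t, Measure.map (fun ω => (E t ω, U t ω)) μ =
      D.prod (volume.restrict (Set.Icc (0 : ℝ) 1)))
    (hm : ∀ h ∈ H, Measurable fun e : X × Y => ℓ (h e.1) e.2) (t : ℕ) (L : ℝ) :
    μ {ω | L ≤ (state T δ ℓ H E U t ω).probSum - 2 * ∑ s ∈ Finset.range t,
      ∫ e, disagreement ℓ (state T δ ℓ H E U s ω).space e ∂D} ≤ ENNReal.ofReal (Real.exp (-L)) := by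
  have hint := fun V hV => integrable_disagreement (D := D) (V := V) hℓ hm hV
  obtain ⟨h1, h2⟩ := lintegral_prod_le_one (T := T) (δ := δ) hE hU hind hmap hm
    (K := fun V x => ENNReal.ofReal (Real.exp (disagreement ℓ V x.1 -
      2 * ∫ e, disagreement ℓ V e ∂D)))
    (fun V hV => (Real.measurable_exp.comp (((measurable_disagreement hm hV).comp
      measurable_fst).sub_const _)).ennreal_ofReal)
    (fun V hV => by
      rw [lintegral_prod _ (Measurable.aemeasurable (by
        exact (Real.measurable_exp.comp (((measurable_disagreement hm hV).comp
          measurable_fst).sub_const _)).ennreal_ofReal))]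
      set I := ∫ e, disagreement ℓ V e ∂D with hI
      have hI' := hint V hV
      calc _ ≤ ∫⁻ e, ENNReal.ofReal ((1 + 2 * disagreement ℓ V e) * Real.exp (-(2 * I))) ∂D := by
            refine lintegral_mono fun e => ?_
            simp only [lintegral_const, Measure.restrict_apply MeasurableSet.univ, Set.univ_inter,
              Real.volume_Icc, sub_zero, ENNReal.ofReal_one, mul_one]
            refine ENNReal.ofReal_le_ofReal ?_
            rw [sub_eq_add_neg, Real.exp_add]
            exact mul_le_mul_of_nonneg_right (exp_le_one_add_two_mul disagreement_nonneg
              (disagreement_le_one hℓ)) (Real.exp_pos _).le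
        _ = ENNReal.ofReal (∫ e, (1 + 2 * disagreement ℓ V e) * Real.exp (-(2 * I)) ∂D) := by
            rw [ofReal_integral_eq_lintegral_ofReal]
            · exact ((integrable_const 1).add (hI'.const_mul 2)).mul_const _
            · exact ae_of_all _ fun e => mul_nonneg
                (by have := disagreement_nonneg (ℓ := ℓ) (V := V) (e := e); linarith)
                (Real.exp_pos _).le
        _ ≤ 1 := by
            rw [ENNReal.ofReal_le_one, integral_mul_const, integral_add (integrable_const 1)
              (hI'.const_mul 2), integral_const_mul]
            have h1 := Real.add_one_le_exp (2 * I)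
            have h2 : Real.exp (2 * I) * Real.exp (-(2 * I)) = 1 := by
              rw [← Real.exp_add]; simp
            simp only [integral_const, probReal_univ, smul_eq_mul, mul_one]
            calc _ ≤ Real.exp (2 * I) * Real.exp (-(2 * I)) := by gcongr; linarith
              _ = 1 := h2) t
  refine measure_le_exp_neg h1 h2 ?_
  intro ω hω
  rw [← ENNReal.ofReal_prod_of_nonneg fun _ _ => (Real.exp_pos _).le, ← Real.exp_sum]
  refine ENNReal.ofReal_le_ofReal (Real.exp_le_exp.2 ?_)
  rw [Finset.sum_sub_distrib, ← Finset.mul_sum]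
  rw [Set.mem_ofPred_eq, state_probSum] at hω
  exact hω

/-- Given the past, the mean sampling probability is the mean disagreement of the version space. -/
theorem condExp_samplingProb [IsProbabilityMeasure μ] (hℓ : ∀ z y, ℓ z y ∈ Set.Icc (0 : ℝ) 1)
    (hE : ∀ t, Measurable (E t)) (hU : ∀ t, Measurable (U t))
    (hind : iIndepFun (fun t ω => (E t ω, U t ω)) μ)
    (hmap : ∀ t, Measure.map (fun ω => (E t ω, U t ω)) μ =
      D.prod (volume.restrict (Set.Icc (0 : ℝ) 1)))
    (hm : ∀ h ∈ H, Measurable fun e : X × Y => ℓ (h e.1) e.2) (t : ℕ) :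
    μ[samplingProb T δ ℓ H E U t | history T δ ℓ H E U t] =ᵐ[μ]
      fun ω => ∫ e, disagreement ℓ (state T δ ℓ H E U t ω).space e ∂D := by
  classical
  have hle : history T δ ℓ H E U t ≤ mΩ := (history_le_pastAlgebra hm).trans (pastAlgebra_le hE hU)
  have hset : ∀ V ⊆ H, MeasurableSet[history T δ ℓ H E U t]
      {ω | (state T δ ℓ H E U t ω).space = V} := fun V hV =>
    measurableSet_finset_eq (m := history T δ ℓ H E U t) (fun _ => state_space_subset)
      (measurableSet_history_mem_space hm) hV
  have hDE : ∀ V ⊆ H, ∫ ω, disagreement ℓ V (E t ω) ∂μ = ∫ e, disagreement ℓ V e ∂D := by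
    intro V hV
    have h1 : Measure.map (E t) μ = D := by
      have : E t = Prod.fst ∘ fun ω => (E t ω, U t ω) := rfl
      rw [this, ← Measure.map_map measurable_fst ((hE t).prodMk (hU t)), hmap t,
        Measure.map_fst_prod]
      simp
    conv_rhs => rw [← h1]
    rw [integral_map (hE t).aemeasurable (measurable_disagreement hm hV).aestronglyMeasurable]
  have hint : ∀ V ⊆ H, Integrable (fun ω => disagreement ℓ V (E t ω)) μ := by
    intro V hV
    exact Integrable.of_bound ((measurable_disagreement hm hV).comp (hE t)).aestronglyMeasurable 1
      (ae_of_all _ fun ω => by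
        rw [Real.norm_eq_abs, abs_of_nonneg disagreement_nonneg]; exact disagreement_le_one hℓ)
  -- For a frozen V the disagreement depends only on the fresh example, which is independent of
  -- `history`.
  have hce : ∀ V ⊆ H, μ[fun ω => disagreement ℓ V (E t ω) | history T δ ℓ H E U t] =ᵐ[μ]
      fun _ => ∫ e, disagreement ℓ V e ∂D := by
    intro V hV
    have hind' : Indep (MeasurableSpace.comap (fun ω => (E t ω, U t ω)) inferInstance)
        (history T δ ℓ H E U t) μ :=
      (indep_of_indep_of_le_left (indep_pastAlgebra hE hU hind t) (history_le_pastAlgebra hm)).symm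
    have := condExp_indep_eq (((hE t).prodMk (hU t)).comap_le) hle
      (f := fun ω => disagreement ℓ V (E t ω))
      (((measurable_disagreement hm hV).comp measurable_fst).comp
        (comap_measurable _)).stronglyMeasurable hind'
    rwa [hDE V hV] at this
  have hdec : samplingProb T δ ℓ H E U t = ∑ V ∈ H.powerset,
      {ω | (state T δ ℓ H E U t ω).space = V}.indicator fun ω => disagreement ℓ V (E t ω) := by
    ext ω
    rw [Finset.sum_apply]
    simp only [Set.indicator_apply, Set.mem_ofPred_eq]
    rw [Finset.sum_ite_eq, if_pos (Finset.mem_powerset.2 state_space_subset), samplingProb_eq]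
  rw [hdec]
  refine (condExp_finsetSum (fun V hV => (hint V (Finset.mem_powerset.1 hV)).indicator
    (hle _ (hset V (Finset.mem_powerset.1 hV)))) _).trans ?_
  have hall : ∀ᵐ ω ∂μ, ∀ V ∈ H.powerset,
      (μ[{ω | (state T δ ℓ H E U t ω).space = V}.indicator fun ω => disagreement ℓ V (E t ω) |
        history T δ ℓ H E U t]) ω =
      {ω | (state T δ ℓ H E U t ω).space = V}.indicator
        (fun _ => ∫ e, disagreement ℓ V e ∂D) ω := by
    rw [Filter.eventually_all_finset]
    intro V hV
    have hV := Finset.mem_powerset.1 hV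
    filter_upwards [condExp_indicator (hint V hV) (hset V hV), hce V hV] with ω h1 h2
    rw [h1]
    simp only [Set.indicator_apply, h2]
  filter_upwards [hall] with ω hω
  rw [Finset.sum_apply, Finset.sum_congr rfl hω]
  simp only [Set.indicator_apply, Set.mem_ofPred_eq]
  rw [Finset.sum_ite_eq, if_pos (Finset.mem_powerset.2 state_space_subset)]

end Supermartingale

end EIWeS

/-! ### Optimization of the exponent -/

namespace EIWeS

variable {X Y Z Ω : Type*}

/-- Optimizing the exponent of the exponential bound over the grid `√(b / k)`. -/
theorem le_of_grid_bounds {T : ℕ} {S P a b : ℝ} (hP : 0 ≤ P) (hPT : P ≤ T) (ha : 1 ≤ a) (hb : 0 < b)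
    (hA : ∀ k : ℕ, k < T → 9 * b ≤ (k : ℝ) + 1 →
      Real.sqrt (b / ((k : ℝ) + 1)) * S - Real.sqrt (b / ((k : ℝ) + 1)) ^ 2 * P < b)
    (hB : 1 / 3 * S - (1 / 3) ^ 2 * P < 4 * Real.sqrt (a * b)) :
    S ≤ 2 * (Real.sqrt P + 6 * Real.sqrt a) * Real.sqrt b := by
  have hRR := Real.sq_sqrt hP
  have hbb := Real.sq_sqrt hb.le
  have hR0 := Real.sqrt_nonneg P
  have hb0 := Real.sqrt_pos.2 hb
  have ha1 : 1 ≤ Real.sqrt a := Real.one_le_sqrt.2 ha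
  -- The grid point used is k + 1 = ⌈P⌉; its exponent √(b/⌈P⌉) is at most 1/3 precisely in this
  -- case.
  by_cases hc : 9 * b ≤ (⌈P⌉₊ : ℝ)
  · have hk0 : 0 < ⌈P⌉₊ := by
      have : (0 : ℝ) < ⌈P⌉₊ := by linarith
      exact_mod_cast this
    obtain ⟨k, hk⟩ : ∃ k, ⌈P⌉₊ = k + 1 := ⟨⌈P⌉₊ - 1, by omega⟩
    have hkT : k < T := by
      have := Nat.ceil_le.2 hPT
      omega
    have hPk : P ≤ (k : ℝ) + 1 := by
      have := Nat.le_ceil P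
      rw [hk] at this; exact_mod_cast this
    have hkP : (k : ℝ) + 1 < P + 1 := by
      have := Nat.ceil_lt_add_one hP
      rw [hk] at this; exact_mod_cast this
    rw [hk] at hc
    have h := hA k hkT (by exact_mod_cast hc)
    have hk1 : (0 : ℝ) < (k : ℝ) + 1 := by positivity
    rw [Real.sqrt_div hb.le] at h
    set q := Real.sqrt ((k : ℝ) + 1) with hq
    have hq0 : 0 < q := Real.sqrt_pos.2 hk1
    have hqq : q ^ 2 = (k : ℝ) + 1 := Real.sq_sqrt hk1.le
    -- Rounding P up costs 1 under the root, which the term 6√a ≥ 6 swallows.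
    have hqR : q ≤ Real.sqrt P + 1 := by
      apply Real.sqrt_le_iff.2 ⟨by positivity, by nlinarith⟩
    set β := Real.sqrt b
    have h1 : (β / q) ^ 2 * P ≤ b := by
      rw [div_pow, hbb, hqq, div_mul_eq_mul_div, div_le_iff₀ hk1]
      exact mul_le_mul_of_nonneg_left hPk hb.le
    have h2 : β / q * S < 2 * β ^ 2 := by linarith
    rw [div_mul_eq_mul_div, div_lt_iff₀ hq0] at h2
    have h3 : S < 2 * β * q := by
      have : β * S < β * (2 * β * q) := by nlinarith
      exact lt_of_mul_lt_mul_left this hb0.le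
    nlinarith [mul_le_mul_of_nonneg_left hqR hb0.le, mul_le_mul_of_nonneg_left ha1 hb0.le]
  -- Here λ = 1/3 gives S < P/3 + 12√(ab), and P/3 ≤ √P·√b. This case is the source of the 6 in the
  -- slack.
  · have hPb : P < 9 * b := (Nat.le_ceil P).trans_lt (not_le.1 hc)
    rw [Real.sqrt_mul (by linarith)] at hB
    have h1 : Real.sqrt P ≤ 3 * Real.sqrt b := Real.sqrt_le_iff.2 ⟨by positivity, by nlinarith⟩
    nlinarith [mul_le_mul_of_nonneg_left h1 hR0]

/-! ### The disagreement coefficient -/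

section Theta

theorem abs_loss_sub_le_one {ℓ : Z → Y → ℝ} (hℓ : ∀ z y, ℓ z y ∈ Set.Icc (0 : ℝ) 1) (f g : X → Z) (e : X × Y) :
    |ℓ (f e.1) e.2 - ℓ (g e.1) e.2| ≤ 1 := by
  have h1 := hℓ (f e.1) e.2
  have h2 := hℓ (g e.1) e.2
  exact abs_le.2 ⟨by linarith [h1.1, h2.2], by linarith [h1.2, h2.1]⟩

variable [MeasurableSpace X] [MeasurableSpace Y] {D : Measure (X × Y)} {ℓ : Z → Y → ℝ}
  {H : Finset (X → Z)} {hs : X → Z} {r : ℝ}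

theorem finite_ballS : Finite (ballS D ℓ H hs r) :=
  (H.finite_toSet.subset fun _ h => h.1).to_subtype

theorem abs_le_iSup_ballS {h : X → Z} (hh : h ∈ ballS D ℓ H hs r) (e : X × Y) :
    |ℓ (h e.1) e.2 - ℓ (hs e.1) e.2| ≤
      ⨆ h : ballS D ℓ H hs r, |ℓ ((h : X → Z) e.1) e.2 - ℓ (hs e.1) e.2| := by
  have := finite_ballS (D := D) (ℓ := ℓ) (H := H) (hs := hs) (r := r)
  exact le_ciSup (f := fun h : ballS D ℓ H hs r => |ℓ ((h : X → Z) e.1) e.2 - ℓ (hs e.1) e.2|)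
    (Set.finite_range _).bddAbove ⟨h, hh⟩

theorem thetaS_nonneg : 0 ≤ thetaS D ℓ H hs :=
  Real.iSup_nonneg fun r => div_nonneg (integral_nonneg fun _ => Real.iSup_nonneg fun _ =>
    abs_nonneg _) r.2.le

variable [IsProbabilityMeasure D]

theorem integrable_abs_sub (hℓ : ∀ z y, ℓ z y ∈ Set.Icc (0 : ℝ) 1)
    (hm : ∀ h ∈ H, Measurable fun e : X × Y => ℓ (h e.1) e.2) {f g : X → Z} (hf : f ∈ H)
    (hg : g ∈ H) : Integrable (fun e : X × Y => |ℓ (f e.1) e.2 - ℓ (g e.1) e.2|) D :=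
  ((integrable_loss hℓ (hm f hf)).sub (integrable_loss hℓ (hm g hg))).abs

theorem integrable_iSup_ballS (hℓ : ∀ z y, ℓ z y ∈ Set.Icc (0 : ℝ) 1)
    (hm : ∀ h ∈ H, Measurable fun e : X × Y => ℓ (h e.1) e.2) (hsH : hs ∈ H) :
    Integrable (fun e : X × Y =>
      ⨆ h : ballS D ℓ H hs r, |ℓ ((h : X → Z) e.1) e.2 - ℓ (hs e.1) e.2|) D := by
  have := finite_ballS (D := D) (ℓ := ℓ) (H := H) (hs := hs) (r := r)
  refine Integrable.of_bound (Measurable.iSup fun h : ballS D ℓ H hs r =>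
    ((hm _ h.2.1).sub (hm _ hsH)).abs).aestronglyMeasurable 1 (ae_of_all _ fun e => ?_)
  rw [Real.norm_eq_abs, abs_of_nonneg (Real.iSup_nonneg fun _ => abs_nonneg _)]
  exact Real.iSup_le (fun h => abs_loss_sub_le_one hℓ _ _ e) zero_le_one

/-- The maximum over the ball is at most the sum, and each summand integrates to at most r. This
gives θ_S ≤ N and also the boundedness without which the real supremum would be a default value. -/
theorem integral_iSup_ballS_le (hℓ : ∀ z y, ℓ z y ∈ Set.Icc (0 : ℝ) 1)
    (hm : ∀ h ∈ H, Measurable fun e : X × Y => ℓ (h e.1) e.2) (hsH : hs ∈ H) (hr : 0 ≤ r) :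
    ∫ e, (⨆ h : ballS D ℓ H hs r, |ℓ ((h : X → Z) e.1) e.2 - ℓ (hs e.1) e.2|) ∂D ≤
      H.card * r := by
  classical
  set B := H.filter fun h => rhoS D ℓ h hs ≤ r with hB
  have hBH : B ⊆ H := Finset.filter_subset _ _
  have hint : ∀ h ∈ B, Integrable (fun e : X × Y => |ℓ (h e.1) e.2 - ℓ (hs e.1) e.2|) D :=
    fun h hh => integrable_abs_sub hℓ hm (hBH hh) hsH
  calc _ ≤ ∫ e, ∑ h ∈ B, |ℓ (h e.1) e.2 - ℓ (hs e.1) e.2| ∂D := by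
        refine integral_mono (integrable_iSup_ballS hℓ hm hsH) (integrable_finsetSum _ hint)
          fun e => ?_
        refine Real.iSup_le (fun h => ?_) (Finset.sum_nonneg fun _ _ => abs_nonneg _)
        exact Finset.single_le_sum (f := fun h : X → Z => |ℓ (h e.1) e.2 - ℓ (hs e.1) e.2|)
          (fun _ _ => abs_nonneg _) (Finset.mem_filter.2 h.2)
    _ = ∑ h ∈ B, rhoS D ℓ h hs := integral_finsetSum _ hint
    _ ≤ ∑ _h ∈ B, r := Finset.sum_le_sum fun h hh => (Finset.mem_filter.1 hh).2
    _ ≤ H.card * r := by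
        rw [Finset.sum_const, nsmul_eq_mul]
        gcongr

theorem thetaS_quotient_le (hℓ : ∀ z y, ℓ z y ∈ Set.Icc (0 : ℝ) 1)
    (hm : ∀ h ∈ H, Measurable fun e : X × Y => ℓ (h e.1) e.2) (hsH : hs ∈ H)
    (r : Set.Ioi (0 : ℝ)) :
    (∫ e, (⨆ h : ballS D ℓ H hs (r : ℝ), |ℓ ((h : X → Z) e.1) e.2 - ℓ (hs e.1) e.2|) ∂D) / (r : ℝ)
      ≤ H.card := by
  rw [div_le_iff₀ r.2]
  exact integral_iSup_ballS_le hℓ hm hsH r.2.le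

theorem thetaS_le_card (hℓ : ∀ z y, ℓ z y ∈ Set.Icc (0 : ℝ) 1)
    (hm : ∀ h ∈ H, Measurable fun e : X × Y => ℓ (h e.1) e.2) (hsH : hs ∈ H) :
    thetaS D ℓ H hs ≤ H.card :=
  Real.iSup_le (thetaS_quotient_le hℓ hm hsH) (Nat.cast_nonneg _)

theorem integral_iSup_ballS_le_thetaS (hℓ : ∀ z y, ℓ z y ∈ Set.Icc (0 : ℝ) 1)
    (hm : ∀ h ∈ H, Measurable fun e : X × Y => ℓ (h e.1) e.2) (hsH : hs ∈ H) (hr : 0 < r) :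
    ∫ e, (⨆ h : ballS D ℓ H hs r, |ℓ ((h : X → Z) e.1) e.2 - ℓ (hs e.1) e.2|) ∂D ≤
      thetaS D ℓ H hs * r := by
  rw [← div_le_iff₀ hr]
  refine le_ciSup (f := fun r : Set.Ioi (0 : ℝ) => (∫ e, (⨆ h : ballS D ℓ H hs (r : ℝ),
    |ℓ ((h : X → Z) e.1) e.2 - ℓ (hs e.1) e.2|) ∂D) / (r : ℝ)) ⟨H.card, ?_⟩ ⟨r, hr⟩
  rintro _ ⟨r, rfl⟩
  exact thetaS_quotient_le hℓ hm hsH r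

/-- Triangle inequality through h⋆: both members of a pair deviate from it by at most the maximum
over the ball, whence the 2. -/
theorem integral_disagreement_le_thetaS (hℓ : ∀ z y, ℓ z y ∈ Set.Icc (0 : ℝ) 1)
    (hm : ∀ h ∈ H, Measurable fun e : X × Y => ℓ (h e.1) e.2) (hsH : hs ∈ H) (hr : 0 < r)
    {V : Finset (X → Z)} (hV : V ⊆ H) (hVr : ∀ h ∈ V, rhoS D ℓ h hs ≤ r) :
    ∫ e, disagreement ℓ V e ∂D ≤ 2 * (thetaS D ℓ H hs * r) := by
  refine le_trans ?_ (mul_le_mul_of_nonneg_left (integral_iSup_ballS_le_thetaS hℓ hm hsH hr)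
    zero_le_two)
  rw [← integral_const_mul]
  refine integral_mono (integrable_disagreement hℓ hm hV)
    ((integrable_iSup_ballS hℓ hm hsH).const_mul 2) fun e => ?_
  refine Real.iSup_le (fun fg => ?_) (mul_nonneg zero_le_two
    (Real.iSup_nonneg fun _ => abs_nonneg _))
  have h1 := abs_le_iSup_ballS (D := D) (ℓ := ℓ) (H := H) (hs := hs) (r := r)
    (h := fg.1) ⟨hV fg.1.2, hVr _ fg.1.2⟩ e
  have h2 := abs_le_iSup_ballS (D := D) (ℓ := ℓ) (H := H) (hs := hs) (r := r)
    (h := fg.2) ⟨hV fg.2.2, hVr _ fg.2.2⟩ e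
  have h3 := (abs_le.1 h1).2
  have h4 := (abs_le.1 h2).1
  linarith

/-- Losses are nonnegative, so |a - b| ≤ a + b. This puts L(h⋆) into the radius and is the source of
the leading term 4L(h⋆)T. -/
theorem rhoS_le_risk_add_risk (hℓ : ∀ z y, ℓ z y ∈ Set.Icc (0 : ℝ) 1)
    (hm : ∀ h ∈ H, Measurable fun e : X × Y => ℓ (h e.1) e.2) {f g : X → Z} (hf : f ∈ H)
    (hg : g ∈ H) : rhoS D ℓ f g ≤ risk D ℓ f + risk D ℓ g := by
  have hif := integrable_loss (D := D) hℓ (hm f hf)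
  have hig := integrable_loss (D := D) hℓ (hm g hg)
  unfold rhoS risk
  rw [← integral_add hif hig]
  refine integral_mono (integrable_abs_sub hℓ hm hf hg) (hif.add hig) fun e => ?_
  have h1 := (hℓ (f e.1) e.2).1
  have h2 := (hℓ (g e.1) e.2).1
  exact abs_le.2 ⟨by simp; linarith, by simp; linarith⟩

theorem integral_disagreement_le_one (hℓ : ∀ z y, ℓ z y ∈ Set.Icc (0 : ℝ) 1)
    {V : Finset (X → Z)} : ∫ e, disagreement ℓ V e ∂D ≤ 1 := by
  have h := norm_integral_le_of_norm_le_const (μ := D) (f := disagreement ℓ V) (C := 1)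
    (ae_of_all _ fun e => by
      rw [Real.norm_eq_abs, abs_of_nonneg disagreement_nonneg]; exact disagreement_le_one hℓ)
  simp only [probReal_univ, mul_one] at h
  exact (le_abs_self _).trans h

end Theta

/-! ### Consequences of the deviation bound along one run -/

section GoodRun

variable [MeasurableSpace X] [MeasurableSpace Y] {D : Measure (X × Y)} {T : ℕ} {δ : ℝ} {ℓ : Z → Y → ℝ} {H : Finset (X → Z)}
  {E : ℕ → Ω → X × Y} {U : ℕ → Ω → ℝ} {ω : Ω} {hs : X → Z}

/-- Since h⋆ has the smaller risk, the deviation bound alone keeps its empirical excess within the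
slack. Induction is needed because the bound only concerns hypotheses still present. -/
theorem optimal_mem_space (hsH : hs ∈ H) (hmin : ∀ h ∈ H, risk D ℓ hs ≤ risk D ℓ h)
    (hdev : ∀ t < T, ∀ h ∈ (state T δ ℓ H E U t ω).space, hs ∈ (state T δ ℓ H E U t ω).space →
      (state T δ ℓ H E U (t + 1) ω).weightedLoss hs - (state T δ ℓ H E U (t + 1) ω).weightedLoss h -
        ((t + 1 : ℕ) : ℝ) * (risk D ℓ hs - risk D ℓ h) ≤
      ((t + 1 : ℕ) : ℝ) * slack T H.card δ (t + 1) (state T δ ℓ H E U (t + 1) ω).probSum) :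
    ∀ t ≤ T, hs ∈ (state T δ ℓ H E U t ω).space := by
  intro t
  induction t with
  | zero => exact fun _ => hsH
  | succ t ih =>
    intro ht
    have h0 := ih (by omega)
    refine mem_state_space_succ.2 ⟨h0, ?_⟩
    rw [← sub_le_iff_le_add]
    have : Nonempty (state T δ ℓ H E U t ω).space := ⟨⟨hs, h0⟩⟩
    refine le_ciInf fun h' => ?_
    have h1 := hdev t ht h' h'.2 h0
    have h2 := hmin h' (state_space_subset h'.2)
    have hpos : (0 : ℝ) < ((t + 1 : ℕ) : ℝ) := by positivity
    rw [sub_le_iff_le_add, one_div, inv_mul_le_iff₀ hpos, mul_add, mul_inv_cancel_left₀ hpos.ne']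
    nlinarith

/-- One slack comes from the elimination rule and one from the deviation bound. The same one-sided
bound, with h⋆ as first hypothesis, serves here and in `optimal_mem_space`, so the union bound runs
over N hypotheses rather than pairs. -/
theorem risk_le_of_mem_space (hsH : hs ∈ H) (hmin : ∀ h ∈ H, risk D ℓ hs ≤ risk D ℓ h)
    (hdev : ∀ t < T, ∀ h ∈ (state T δ ℓ H E U t ω).space, hs ∈ (state T δ ℓ H E U t ω).space →
      (state T δ ℓ H E U (t + 1) ω).weightedLoss hs - (state T δ ℓ H E U (t + 1) ω).weightedLoss h -
        ((t + 1 : ℕ) : ℝ) * (risk D ℓ hs - risk D ℓ h) ≤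
      ((t + 1 : ℕ) : ℝ) * slack T H.card δ (t + 1) (state T δ ℓ H E U (t + 1) ω).probSum)
    {t : ℕ} (ht : t < T) {h : X → Z} (hh : h ∈ (state T δ ℓ H E U (t + 1) ω).space) :
    risk D ℓ h ≤ risk D ℓ hs +
      2 * slack T H.card δ (t + 1) (state T δ ℓ H E U (t + 1) ω).probSum := by
  obtain ⟨h1, h2⟩ := mem_state_space_succ.1 hh
  have h0 := optimal_mem_space hsH hmin hdev t ht.le
  have h3 := hdev t ht h h1 h0
  have h4 := ciInf_le (f := fun h' : (state T δ ℓ H E U t ω).space =>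
    1 / ((t + 1 : ℕ) : ℝ) * (state T δ ℓ H E U (t + 1) ω).weightedLoss (h' : X → Z))
    (Set.finite_range _).bddBelow ⟨hs, h0⟩
  have hpos : (0 : ℝ) < ((t + 1 : ℕ) : ℝ) := by positivity
  have h5 := h2.trans (add_le_add_left h4 _)
  rw [one_div, inv_mul_le_iff₀ hpos, mul_add, mul_inv_cancel_left₀ hpos.ne'] at h5
  have h6 : ((t + 1 : ℕ) : ℝ) * (risk D ℓ h) ≤ ((t + 1 : ℕ) : ℝ) * (risk D ℓ hs +
      2 * slack T H.card δ (t + 1) (state T δ ℓ H E U (t + 1) ω).probSum) := by linarith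
  exact le_of_mul_le_mul_left h6 hpos

theorem integral_disagreement_space_le [IsProbabilityMeasure D]
    (hℓ : ∀ z y, ℓ z y ∈ Set.Icc (0 : ℝ) 1)
    (hm : ∀ h ∈ H, Measurable fun e : X × Y => ℓ (h e.1) e.2)
    (hsH : hs ∈ H) (hmin : ∀ h ∈ H, risk D ℓ hs ≤ risk D ℓ h)
    (hdev : ∀ t < T, ∀ h ∈ (state T δ ℓ H E U t ω).space, hs ∈ (state T δ ℓ H E U t ω).space →
      (state T δ ℓ H E U (t + 1) ω).weightedLoss hs - (state T δ ℓ H E U (t + 1) ω).weightedLoss h -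
        ((t + 1 : ℕ) : ℝ) * (risk D ℓ hs - risk D ℓ h) ≤
      ((t + 1 : ℕ) : ℝ) * slack T H.card δ (t + 1) (state T δ ℓ H E U (t + 1) ω).probSum)
    {t : ℕ} (ht : t < T)
    (hslack : 0 < slack T H.card δ (t + 1) (state T δ ℓ H E U (t + 1) ω).probSum) :
    ∫ e, disagreement ℓ (state T δ ℓ H E U (t + 1) ω).space e ∂D ≤ thetaS D ℓ H hs *
      (4 * risk D ℓ hs + 4 * slack T H.card δ (t + 1) (state T δ ℓ H E U (t + 1) ω).probSum) := by
  have hL : 0 ≤ risk D ℓ hs := integral_nonneg fun e => (hℓ _ _).1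
  -- The supremum in θ_S runs over r > 0 only; positive slack makes the radius admissible even when
  -- L(h⋆) = 0.
  refine (integral_disagreement_le_thetaS hℓ hm hsH (r := 2 * risk D ℓ hs +
    2 * slack T H.card δ (t + 1) (state T δ ℓ H E U (t + 1) ω).probSum) (by linarith)
    state_space_subset fun h hh => ?_).trans (le_of_eq (by ring))
  have h1 := risk_le_of_mem_space hsH hmin hdev ht hh
  have h2 := rhoS_le_risk_add_risk (D := D) hℓ hm (state_space_subset hh) hsH
  linarith

end GoodRun

end EIWeS

namespace EIWeS

/-! ### Confidence levels -/

section Levels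

variable {T N : ℕ} {δ : ℝ}

/-- The confidence term of the slack that depends on the number of hypotheses. -/
noncomputable def globalLevel (T N : ℕ) (δ : ℝ) : ℝ :=
  Real.log (8 * (T : ℝ) ^ 2 * (N : ℝ) ^ 2 * Real.log (T : ℝ) / δ)

/-- The confidence term of the slack that depends on the round. -/
noncomputable def localLevel (δ : ℝ) (t : ℕ) : ℝ :=
  Real.log ((3 + (t : ℝ)) * (t : ℝ) ^ 2 / δ)

theorem slack_eq (t : ℕ) (P : ℝ) : slack T N δ t P =
    2 / (t : ℝ) * (Real.sqrt P + 6 * Real.sqrt (localLevel δ t)) *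
      Real.sqrt (globalLevel T N δ) := rfl

theorem one_le_log_of_three_le {x : ℝ} (hx : 3 ≤ x) : 1 ≤ Real.log x := by
  rw [Real.le_log_iff_exp_le (by linarith)]
  have := Real.exp_one_lt_d9
  linarith

theorem one_le_log_nat (hT : 3 ≤ T) : 1 ≤ Real.log (T : ℝ) :=
  one_le_log_of_three_le (by exact_mod_cast hT)

theorem one_le_localLevel (hδ : 0 < δ) (hδ1 : δ < 1) {t : ℕ} (ht : 1 ≤ t) :
    1 ≤ localLevel δ t := by
  refine one_le_log_of_three_le ?_
  have : (1 : ℝ) ≤ t := by exact_mod_cast ht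
  rw [le_div_iff₀ hδ]
  nlinarith [one_le_pow₀ this (n := 2)]

theorem log_le_globalLevel (hT : 3 ≤ T) (hN : 1 ≤ N) (hδ : 0 < δ) (hδ1 : δ < 1) :
    Real.log (T : ℝ) ≤ globalLevel T N δ := by
  have h1 := one_le_log_nat hT
  have hT' : (3 : ℝ) ≤ T := by exact_mod_cast hT
  have hN' : (1 : ℝ) ≤ (N : ℝ) ^ 2 := one_le_pow₀ (by exact_mod_cast hN)
  refine Real.log_le_log (by linarith) ?_
  rw [le_div_iff₀ hδ]
  calc (T : ℝ) * δ ≤ T * 1 := by gcongr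
    _ ≤ 8 * (T : ℝ) ^ 2 * 1 * 1 := by nlinarith
    _ ≤ 8 * (T : ℝ) ^ 2 * (N : ℝ) ^ 2 * Real.log (T : ℝ) := by gcongr

theorem localLevel_le_globalLevel (hT : 3 ≤ T) (hN : 1 ≤ N) (hδ : 0 < δ) (hδ1 : δ < 1) {t : ℕ}
    (ht : 1 ≤ t) (htT : t ≤ T) : localLevel δ t ≤ 2 * globalLevel T N δ := by
  have h1 := one_le_log_nat hT
  have hT' : (3 : ℝ) ≤ T := by exact_mod_cast hT
  have ht' : (1 : ℝ) ≤ t := by exact_mod_cast ht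
  have htT' : (t : ℝ) ≤ T := by exact_mod_cast htT
  have hN' : (1 : ℝ) ≤ (N : ℝ) ^ 2 := one_le_pow₀ (by exact_mod_cast hN)
  unfold localLevel globalLevel
  rw [← Nat.cast_two (R := ℝ), ← Real.log_pow]
  refine Real.log_le_log (by positivity) ?_
  have h2 : (T : ℝ) ^ 2 ≤ 8 * (T : ℝ) ^ 2 * (N : ℝ) ^ 2 * Real.log (T : ℝ) := by
    calc (T : ℝ) ^ 2 ≤ 8 * (T : ℝ) ^ 2 * 1 * 1 := by nlinarith
      _ ≤ _ := by gcongr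
  rw [div_pow, div_le_div_iff₀ hδ (by positivity)]
  calc (3 + (t : ℝ)) * t ^ 2 * δ ^ 2 ≤ (T + T) * T ^ 2 * δ := by
        gcongr
        nlinarith
    _ ≤ ((T : ℝ) ^ 2) ^ 2 * δ := by gcongr; nlinarith [sq_nonneg (T : ℝ)]
    _ ≤ _ := by gcongr

/-- The total cost of the union over T rounds, N hypotheses and T grid points. -/
theorem exp_neg_globalLevel (hT : 3 ≤ T) (hN : 1 ≤ N) (hδ : 0 < δ) :
    (T : ℝ) * (N * (T * Real.exp (-globalLevel T N δ))) ≤ δ / 8 := by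
  have h1 := one_le_log_nat hT
  have hT' : (3 : ℝ) ≤ T := by exact_mod_cast hT
  have hN' : (1 : ℝ) ≤ N := by exact_mod_cast hN
  have hT0 : (0 : ℝ) < T := by linarith
  have hN0 : (0 : ℝ) < N := by linarith
  rw [globalLevel, Real.exp_neg, Real.exp_log (by positivity), inv_div, ← mul_div_assoc,
    ← mul_div_assoc, ← mul_div_assoc, div_le_div_iff₀ (by positivity) (by norm_num)]
  have h2 : (N : ℝ) * 1 ≤ (N : ℝ) ^ 2 * Real.log T := by
    gcongr
    nlinarith
  have h3 := mul_le_mul_of_nonneg_left h2 (by positivity : 0 ≤ 8 * (T : ℝ) ^ 2 * δ)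
  nlinarith

/-- Write a, b for the two levels. Three copies of √(ab) dominate a, as a ≤ 2b; the fourth is at
least √b ≥ log(4N), for which T must be large in terms of N. What remains is exp(-a)/4, bounded by a
telescoping term. -/
theorem exp_neg_sqrt_levels (hT : 3 ≤ T) (hN : 1 ≤ N) (hδ : 0 < δ) (hδ1 : δ < 1)
    (hTN : Real.exp (Real.log (4 * N) ^ 2) ≤ T) {t : ℕ} (htT : t < T) :
    (N : ℝ) * Real.exp (-(4 * Real.sqrt (localLevel δ (t + 1) * globalLevel T N δ))) ≤
      δ / 4 * (1 / ((t : ℝ) + 1) - 1 / ((t : ℝ) + 2)) := by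
  have ha := one_le_localLevel hδ hδ1 (t := t + 1) (by omega)
  have hab := localLevel_le_globalLevel hT hN hδ hδ1 (t := t + 1) (by omega) htT
  have hb := log_le_globalLevel hT hN hδ hδ1
  have hN' : (1 : ℝ) ≤ N := by exact_mod_cast hN
  have hT0 : (0 : ℝ) < T := by positivity
  have hTN' : Real.log (4 * N) ^ 2 ≤ Real.log T := by
    rwa [Real.le_log_iff_exp_le hT0]
  have hlog : 0 ≤ Real.log (4 * N) := Real.log_nonneg (by linarith)
  have hs : Real.log (4 * N) ≤ Real.sqrt (globalLevel T N δ) :=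
    Real.le_sqrt_of_sq_le (hTN'.trans hb)
  have hexp : Real.exp (-localLevel δ (t + 1)) ≤ δ * (1 / ((t : ℝ) + 1) - 1 / ((t : ℝ) + 2)) := by
    have ht : (0 : ℝ) ≤ t := Nat.cast_nonneg t
    rw [localLevel, Real.exp_neg, Real.exp_log (by positivity), inv_div, div_eq_mul_one_div]
    refine mul_le_mul_of_nonneg_left ?_ hδ.le
    push_cast
    rw [div_sub_div _ _ (by positivity) (by positivity), div_le_div_iff₀ (by positivity)
      (by positivity)]
    nlinarith [mul_nonneg ht ht, mul_nonneg (mul_nonneg ht ht) ht]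
  generalize localLevel δ (t + 1) = a at *
  generalize globalLevel T N δ = b at *
  have h1 : a ≤ 3 * Real.sqrt (a * b) := by
    have : a / 3 ≤ Real.sqrt (a * b) := Real.le_sqrt_of_sq_le (by nlinarith)
    linarith
  have h2 : Real.sqrt b ≤ Real.sqrt (a * b) := Real.sqrt_le_sqrt (by nlinarith)
  have h3 : Real.exp (-(4 * Real.sqrt (a * b))) ≤ Real.exp (-a) * Real.exp (-Real.log (4 * N)) := by
    rw [← Real.exp_add]
    exact Real.exp_le_exp.2 (by linarith)
  rw [Real.exp_neg (Real.log _), Real.exp_log (by linarith)] at h3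
  calc (N : ℝ) * Real.exp (-(4 * Real.sqrt (a * b))) ≤ N * (Real.exp (-a) * (4 * (N : ℝ))⁻¹) := by
        gcongr
    _ = Real.exp (-a) / 4 := by field_simp
    _ ≤ _ := by linarith

/-- All confidence terms are compared with log(T/δ), using log T ≤ T; c depends on N only. -/
theorem levels_le (hT : 3 ≤ T) (hN : 1 ≤ N) (hδ : 0 < δ) (hδ1 : δ < 1) {c : ℝ}
    (hc : c = Real.log ((8 * N ^ 2 : ℕ) : ℝ) + 4) :
    1 ≤ Real.log (T / δ) ∧ Real.log T ≤ Real.log (T / δ) ∧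
      globalLevel T N δ ≤ c * Real.log (T / δ) ∧ Real.log (4 * T / δ) ≤ c * Real.log (T / δ) ∧
      ∀ t, 1 ≤ t → t < T → localLevel δ t ≤ c * Real.log (T / δ) := by
  have h1 := one_le_log_nat hT
  have hT' : (3 : ℝ) ≤ T := by exact_mod_cast hT
  have hT0 : (0 : ℝ) < T := by linarith
  have hN0 : (0 : ℝ) < N := by exact_mod_cast hN
  have hc0 : 0 ≤ Real.log ((8 * N ^ 2 : ℕ) : ℝ) := Real.log_natCast_nonneg _
  have hlδ : Real.log δ < 0 := Real.log_neg hδ hδ1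
  have hΛ : Real.log (T / δ) = Real.log T - Real.log δ := Real.log_div hT0.ne' hδ.ne'
  set Lam := Real.log (T / δ)
  have hΛ1 : 1 ≤ Lam := by linarith
  have hcΛ : Real.log ((8 * N ^ 2 : ℕ) : ℝ) + 4 * Lam ≤ c * Lam := by rw [hc]; nlinarith
  have h4 : Real.log 4 ≤ 3 := by
    have := Real.log_le_sub_one_of_pos (show (0 : ℝ) < 4 by norm_num)
    linarith
  have h2 : Real.log 2 ≤ 1 := by
    have := Real.log_le_sub_one_of_pos (show (0 : ℝ) < 2 by norm_num)
    linarith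
  refine ⟨hΛ1, by linarith, ?_, ?_, ?_⟩
  · have : globalLevel T N δ ≤ Real.log (((8 * N ^ 2 : ℕ) : ℝ) * (T : ℝ) ^ 3 / δ) := by
      refine Real.log_le_log (by positivity) ?_
      have := Real.log_le_self hT0.le
      push_cast
      refine div_le_div_of_nonneg_right ?_ hδ.le
      calc 8 * (T : ℝ) ^ 2 * (N : ℝ) ^ 2 * Real.log T ≤ 8 * (T : ℝ) ^ 2 * (N : ℝ) ^ 2 * T := by
            gcongr
        _ = _ := by ring
    rw [Real.log_div (by positivity) hδ.ne', Real.log_mul (by positivity) (by positivity),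
      Real.log_pow] at this
    push_cast at this hcΛ
    linarith
  · rw [mul_div_assoc, Real.log_mul (by norm_num) (by positivity)]
    linarith
  · intro t ht htT
    have ht' : (1 : ℝ) ≤ t := by exact_mod_cast ht
    have htT' : (t : ℝ) ≤ T := by exact_mod_cast htT.le
    have : localLevel δ t ≤ Real.log (2 * (T : ℝ) ^ 3 / δ) := by
      refine Real.log_le_log (by positivity) ?_
      refine div_le_div_of_nonneg_right ?_ hδ.le
      calc (3 + (t : ℝ)) * t ^ 2 ≤ (T + T) * T ^ 2 := by gcongr
        _ = _ := by ring
    rw [Real.log_div (by positivity) hδ.ne', Real.log_mul (by positivity) (by positivity),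
      Real.log_pow] at this
    push_cast at this
    linarith

end Levels

/-! ### The good event and its probability -/

section GoodEvent

variable {X Y Z Ω : Type*} {T : ℕ} {δ : ℝ} {ℓ : Z → Y → ℝ} {H : Finset (X → Z)} {E : ℕ → Ω → X × Y} {U : ℕ → Ω → ℝ}
  {hs : X → Z}

theorem samplingProb_mem_Icc (hℓ : ∀ z y, ℓ z y ∈ Set.Icc (0 : ℝ) 1) (t : ℕ) (ω : Ω) :
    samplingProb T δ ℓ H E U t ω ∈ Set.Icc (0 : ℝ) 1 :=
  ⟨disagreement_nonneg, disagreement_le_one hℓ⟩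

theorem probSum_le (hℓ : ∀ z y, ℓ z y ∈ Set.Icc (0 : ℝ) 1) (t : ℕ) (ω : Ω) :
    (state T δ ℓ H E U t ω).probSum ≤ t := by
  rw [state_probSum]
  calc _ ≤ ∑ s ∈ Finset.range t, (1 : ℝ) :=
        Finset.sum_le_sum fun s _ => (samplingProb_mem_Icc hℓ s ω).2
    _ = t := by simp

theorem probSum_nonneg (hℓ : ∀ z y, ℓ z y ∈ Set.Icc (0 : ℝ) 1) (t : ℕ) (ω : Ω) :
    0 ≤ (state T δ ℓ H E U t ω).probSum := by
  rw [state_probSum]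
  exact Finset.sum_nonneg fun s _ => (samplingProb_mem_Icc hℓ s ω).1

theorem probSum_monotone (hℓ : ∀ z y, ℓ z y ∈ Set.Icc (0 : ℝ) 1) (ω : Ω) :
    Monotone fun t => (state T δ ℓ H E U t ω).probSum :=
  monotone_nat_of_le_succ fun t => by
    simp only [state_probSum_succ]
    linarith [(samplingProb_mem_Icc (T := T) (δ := δ) (H := H) (E := E) (U := U) hℓ t ω).1]

variable [MeasurableSpace X] [MeasurableSpace Y] {mΩ : MeasurableSpace Ω}
  {D : Measure (X × Y)} {μ : Measure Ω}

/-- The event that the importance weighted estimate for `f` and `g` exceeds the exponential bound. -/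
def deviationEvent (D : Measure (X × Y)) (T : ℕ) (δ : ℝ) (ℓ : Z → Y → ℝ) (H : Finset (X → Z))
    (E : ℕ → Ω → X × Y) (U : ℕ → Ω → ℝ) (f g : X → Z) (lam : ℝ) (t : ℕ) (L : ℝ) : Set Ω :=
  {ω | f ∈ (state T δ ℓ H E U t ω).space ∧ g ∈ (state T δ ℓ H E U t ω).space ∧
    L ≤ lam * ((state T δ ℓ H E U (t + 1) ω).weightedLoss f -
      (state T δ ℓ H E U (t + 1) ω).weightedLoss g -
        ((t + 1 : ℕ) : ℝ) * (risk D ℓ f - risk D ℓ g)) -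
        lam ^ 2 * (state T δ ℓ H E U (t + 1) ω).probSum}

/-- With probability at least `1 - δ` the importance weighted estimates stay within the slack, and
the sampled mass is comparable to its compensator. -/
theorem measureReal_good_event [IsProbabilityMeasure D] [IsProbabilityMeasure μ]
    (hℓ : ∀ z y, ℓ z y ∈ Set.Icc (0 : ℝ) 1)
    (hE : ∀ t, Measurable (E t)) (hU : ∀ t, Measurable (U t))
    (hind : iIndepFun (fun t ω => (E t ω, U t ω)) μ)
    (hmap : ∀ t, Measure.map (fun ω => (E t ω, U t ω)) μ =
      D.prod (volume.restrict (Set.Icc (0 : ℝ) 1)))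
    (hm : ∀ h ∈ H, Measurable fun e : X × Y => ℓ (h e.1) e.2) (hsH : hs ∈ H)
    (hδ : 0 < δ) (hδ1 : δ < 1) (hT : 3 ≤ T)
    (hTN : Real.exp (Real.log (4 * H.card) ^ 2) ≤ T) {G : Set Ω}
    (hG : ∀ ω,
      (∀ t < T, ∀ h ∈ (state T δ ℓ H E U t ω).space, hs ∈ (state T δ ℓ H E U t ω).space →
        (state T δ ℓ H E U (t + 1) ω).weightedLoss hs -
          (state T δ ℓ H E U (t + 1) ω).weightedLoss h -
          ((t + 1 : ℕ) : ℝ) * (risk D ℓ hs - risk D ℓ h) ≤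
        ((t + 1 : ℕ) : ℝ) * slack T H.card δ (t + 1) (state T δ ℓ H E U (t + 1) ω).probSum) →
      (∀ t ≤ T, (state T δ ℓ H E U t ω).probSum ≤ 2 * ∑ s ∈ Finset.range t,
        ∫ e, disagreement ℓ (state T δ ℓ H E U s ω).space e ∂D + Real.log (4 * T / δ)) →
      (∀ t, (μ[samplingProb T δ ℓ H E U t | history T δ ℓ H E U t]) ω =
        ∫ e, disagreement ℓ (state T δ ℓ H E U t ω).space e ∂D) → ω ∈ G) :
    1 - δ ≤ μ.real G := by
  have hN : 1 ≤ H.card := Finset.card_pos.2 ⟨hs, hsH⟩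
  have hT' : (3 : ℝ) ≤ T := by exact_mod_cast hT
  have hT0 : (0 : ℝ) < T := by linarith
  set b := globalLevel T H.card δ with hb
  have hb1 : 1 ≤ b := (one_le_log_nat hT).trans (log_le_globalLevel hT hN hδ hδ1)
  classical
  -- Only grid points whose exponent is at most 1/3 are admissible for the tail bound.
  set KA := (Finset.range T).filter fun k : ℕ => 9 * b ≤ (k : ℝ) + 1 with hKA
  set BA : Set Ω := ⋃ t ∈ Finset.range T, ⋃ h ∈ H, ⋃ k ∈ KA,
    deviationEvent D T δ ℓ H E U hs h (Real.sqrt (b / ((k : ℝ) + 1))) t b with hBA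
  set BB : Set Ω := ⋃ t ∈ Finset.range T, ⋃ h ∈ H,
    deviationEvent D T δ ℓ H E U hs h (1 / 3) t (4 * Real.sqrt (localLevel δ (t + 1) * b)) with hBB
  set BC : Set Ω := ⋃ t ∈ Finset.range T, {ω | Real.log (4 * T / δ) ≤
    (state T δ ℓ H E U (t + 1) ω).probSum - 2 * ∑ s ∈ Finset.range (t + 1),
      ∫ e, disagreement ℓ (state T δ ℓ H E U s ω).space e ∂D} with hBC
  have hreal : ∀ (B : Set Ω) (L : ℝ), μ B ≤ ENNReal.ofReal (Real.exp (-L)) →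
      μ.real B ≤ Real.exp (-L) := fun B L h => ENNReal.toReal_le_of_le_ofReal (Real.exp_pos _).le h
  have htail : ∀ h lam t L, 0 < lam → lam ≤ 1 / 3 →
      μ.real (deviationEvent D T δ ℓ H E U hs h lam t L) ≤ Real.exp (-L) := fun h lam t L hl hl3 =>
    hreal _ _ (deviation_tail hℓ hE hU hind hmap hm hs h hl hl3 t L)
  have hA : μ.real BA ≤ δ / 8 := by
    refine le_trans ?_ (exp_neg_globalLevel hT hN hδ)
    calc μ.real BA ≤ ∑ t ∈ Finset.range T, ∑ h ∈ H, ∑ k ∈ KA, Real.exp (-b) := by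
          refine (measureReal_biUnion_finset_le _ _).trans (Finset.sum_le_sum fun t _ => ?_)
          refine (measureReal_biUnion_finset_le _ _).trans (Finset.sum_le_sum fun h _ => ?_)
          refine (measureReal_biUnion_finset_le _ _).trans (Finset.sum_le_sum fun k hk => ?_)
          have hk := (Finset.mem_filter.1 hk).2
          refine htail _ _ _ _ (Real.sqrt_pos.2 (by positivity)) ?_
          refine Real.sqrt_le_iff.2 ⟨by norm_num, ?_⟩
          rw [div_le_iff₀ (by positivity)]
          linarith
      _ ≤ ∑ t ∈ Finset.range T, ∑ h ∈ H, ∑ k ∈ Finset.range T, Real.exp (-b) := by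
          gcongr
          exact Finset.filter_subset _ _
      _ = _ := by rw [← hb]; simp
  have hB : μ.real BB ≤ δ / 4 := by
    calc μ.real BB ≤ ∑ t ∈ Finset.range T,
          δ / 4 * (1 / ((t : ℝ) + 1) - 1 / ((t : ℝ) + 2)) := by
          refine (measureReal_biUnion_finset_le _ _).trans (Finset.sum_le_sum fun t ht => ?_)
          refine le_trans ?_ (exp_neg_sqrt_levels hT hN hδ hδ1 hTN (Finset.mem_range.1 ht))
          refine (measureReal_biUnion_finset_le _ _).trans ?_
          rw [← nsmul_eq_mul, ← Finset.sum_const]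
          exact Finset.sum_le_sum fun h _ => htail _ _ _ _ (by norm_num) le_rfl
      _ = δ / 4 * (1 - 1 / ((T : ℝ) + 1)) := by
          rw [← Finset.mul_sum]
          congr 1
          have := Finset.sum_range_sub' (fun t : ℕ => 1 / ((t : ℝ) + 1)) T
          push_cast at this
          simp only [add_assoc, one_add_one_eq_two] at this
          simpa using this
      _ ≤ δ / 4 := by
          have : 0 ≤ 1 / ((T : ℝ) + 1) := by positivity
          nlinarith
  have hC : μ.real BC ≤ δ / 4 := by
    calc μ.real BC ≤ ∑ t ∈ Finset.range T, Real.exp (-Real.log (4 * T / δ)) := by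
          refine (measureReal_biUnion_finset_le _ _).trans (Finset.sum_le_sum fun t _ => ?_)
          exact hreal _ _ (mass_tail hℓ hE hU hind hmap hm (t + 1) _)
      _ = δ / 4 := by
          rw [Finset.sum_const, Finset.card_range, nsmul_eq_mul, Real.exp_neg,
            Real.exp_log (by positivity)]
          field_simp
  set NN : Set Ω := {ω | ¬ ∀ t, (μ[samplingProb T δ ℓ H E U t | history T δ ℓ H E U t]) ω =
        ∫ e, disagreement ℓ (state T δ ℓ H E U t ω).space e ∂D} with hNN
  have hnull : μ.real NN = 0 := by
    have : ∀ᵐ ω ∂μ, ∀ t, (μ[samplingProb T δ ℓ H E U t | history T δ ℓ H E U t]) ω =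
        ∫ e, disagreement ℓ (state T δ ℓ H E U t ω).space e ∂D :=
      ae_all_iff.2 fun t => condExp_samplingProb hℓ hE hU hind hmap hm t
    rw [measureReal_def, ae_iff.1 this, ENNReal.toReal_zero]
  -- G need not be measurable, so its measure is bounded below by subadditivity from a cover of Ω;
  -- the exceptional sets cost δ/8 + δ/4 + δ/4 + 0.
  have hcover : (Set.univ : Set Ω) ⊆ G ∪ (BA ∪ (BB ∪ (BC ∪ NN))) := by
    intro ω _
    by_contra hω
    simp only [Set.mem_union, not_or] at hω
    obtain ⟨hωG, hωA, hωB, hωC, hωN⟩ := hω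
    refine hωG (hG ω ?_ ?_ (not_not.1 hωN))
    · intro t ht h hh hhs
      have hpos : (0 : ℝ) < ((t + 1 : ℕ) : ℝ) := by positivity
      have e1 : ((t + 1 : ℕ) : ℝ) *
          slack T H.card δ (t + 1) (state T δ ℓ H E U (t + 1) ω).probSum =
          2 * (Real.sqrt (state T δ ℓ H E U (t + 1) ω).probSum +
            6 * Real.sqrt (localLevel δ (t + 1))) * Real.sqrt b := by
        rw [slack_eq, ← hb]; field_simp
      rw [e1]
      refine le_of_grid_bounds (T := T) (probSum_nonneg hℓ _ _)
        ((probSum_le hℓ _ _).trans (by exact_mod_cast ht)) (one_le_localLevel hδ hδ1 (by omega))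
        (by linarith) (fun k hk hbk => ?_) ?_
      · by_contra hcon
        refine hωA ?_
        simp only [hBA, Set.mem_iUnion]
        exact ⟨t, Finset.mem_range.2 ht, h, state_space_subset hh, k,
          Finset.mem_filter.2 ⟨Finset.mem_range.2 hk, hbk⟩, hhs, hh, not_lt.1 hcon⟩
      · by_contra hcon
        refine hωB ?_
        simp only [hBB, Set.mem_iUnion]
        exact ⟨t, Finset.mem_range.2 ht, h, state_space_subset hh, hhs, hh, not_lt.1 hcon⟩
    · intro t ht
      -- `BC` only covers positive times; at time 0 both sums are empty and the logarithm is
      -- nonnegative.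
      rcases Nat.eq_zero_or_pos t with rfl | ht0
      · have h0 : (state T δ ℓ H E U 0 ω).probSum = 0 := rfl
        rw [h0, Finset.sum_range_zero]
        have : 0 ≤ Real.log (4 * T / δ) := Real.log_nonneg (by rw [le_div_iff₀ hδ]; linarith)
        linarith
      · obtain ⟨s, rfl⟩ : ∃ s, t = s + 1 := ⟨t - 1, by omega⟩
        by_contra hcon
        refine hωC ?_
        simp only [hBC, Set.mem_iUnion]
        refine ⟨s, Finset.mem_range.2 (by omega), ?_⟩
        rw [Set.mem_ofPred_eq]
        linarith [not_le.1 hcon]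
  have h1 := measureReal_mono (μ := μ) hcover
  rw [probReal_univ] at h1
  have h2 := measureReal_union_le (μ := μ) G (BA ∪ (BB ∪ (BC ∪ NN)))
  have h3 := measureReal_union_le (μ := μ) BA (BB ∪ (BC ∪ NN))
  have h4 := measureReal_union_le (μ := μ) BB (BC ∪ NN)
  have h5 := measureReal_union_le (μ := μ) BC NN
  linarith

theorem expectedSamplingRate_le_rounds [IsProbabilityMeasure D] [IsProbabilityMeasure μ]
    (hℓ : ∀ z y, ℓ z y ∈ Set.Icc (0 : ℝ) 1)
    (hE : ∀ t, Measurable (E t)) (hU : ∀ t, Measurable (U t))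
    (hind : iIndepFun (fun t ω => (E t ω, U t ω)) μ)
    (hmap : ∀ t, Measure.map (fun ω => (E t ω, U t ω)) μ =
      D.prod (volume.restrict (Set.Icc (0 : ℝ) 1)))
    (hm : ∀ h ∈ H, Measurable fun e : X × Y => ℓ (h e.1) e.2) :
    ∀ᵐ ω ∂μ, expectedSamplingRate μ T δ ℓ H E U ω ≤ T := by
  have : ∀ᵐ ω ∂μ, ∀ t, (μ[samplingProb T δ ℓ H E U t | history T δ ℓ H E U t]) ω =
      ∫ e, disagreement ℓ (state T δ ℓ H E U t ω).space e ∂D :=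
    ae_all_iff.2 fun t => condExp_samplingProb hℓ hE hU hind hmap hm t
  filter_upwards [this] with ω hω
  calc expectedSamplingRate μ T δ ℓ H E U ω ≤ ∑ t ∈ Finset.range T, (1 : ℝ) :=
        Finset.sum_le_sum fun t _ => by
          rw [hω t]
          exact integral_disagreement_le_one hℓ
    _ = T := by simp

end GoodEvent

/-! ### Assembly of the constant -/

theorem exists_rate_constant (N : ℕ) :
    ∃ C : ℝ, 0 < C ∧
      ∀ {X Y Z Ω : Type*} [MeasurableSpace X] [MeasurableSpace Y] [MeasurableSpace Ω]
        (D : Measure (X × Y)) [IsProbabilityMeasure D]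
        (ℓ : Z → Y → ℝ) (_ : ∀ z y, ℓ z y ∈ Set.Icc (0 : ℝ) 1)
        (H : Finset (X → Z)) (_ : H.card = N)
        (_ : ∀ h ∈ H, Measurable fun e : X × Y => ℓ (h e.1) e.2)
        (hs : X → Z) (_ : hs ∈ H) (_ : ∀ h ∈ H, risk D ℓ hs ≤ risk D ℓ h)
        (μ : Measure Ω) [IsProbabilityMeasure μ]
        (E : ℕ → Ω → X × Y) (U : ℕ → Ω → ℝ)
        (_ : ∀ t, Measurable (E t)) (_ : ∀ t, Measurable (U t))
        (_ : iIndepFun (fun t ω => (E t ω, U t ω)) μ)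
        (_ : ∀ t, Measure.map (fun ω => (E t ω, U t ω)) μ =
          D.prod (volume.restrict (Set.Icc (0 : ℝ) 1)))
        (δ : ℝ) (_ : 0 < δ) (T : ℕ) (_ : 3 ≤ T),
        1 - δ ≤ μ.real {ω | expectedSamplingRate μ T δ ℓ H E U ω ≤
          thetaS D ℓ H hs * (4 * risk D ℓ hs * T +
            C * Real.sqrt (risk D ℓ hs * T * Real.log (T / δ))) + C * Real.log (T / δ) ^ 3} := by
  obtain ⟨c, hc⟩ : ∃ c : ℝ, c = Real.log ((8 * N ^ 2 : ℕ) : ℝ) + 4 := ⟨_, rfl⟩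
  obtain ⟨K, hK⟩ : ∃ K : ℝ, K = 16 * N + 4 + 384 * N * c + 2 * c + 1024 * N ^ 2 * c := ⟨_, rfl⟩
  have hc1 : 1 ≤ c := by
    have : 0 ≤ Real.log ((8 * N ^ 2 : ℕ) : ℝ) := Real.log_natCast_nonneg _
    linarith
  have hc0 : 0 ≤ c := by linarith
  set R := 16 * Real.sqrt c * Real.sqrt K with hR
  have hR0 : 0 ≤ R := by positivity
  set T₀ := Real.exp (Real.log (4 * N) ^ 2) with hT₀
  have hT₀0 : 0 < T₀ := Real.exp_pos _
  have hNR : 0 ≤ (N : ℝ) * (R + 96 * c) := by positivity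
  -- R is the coefficient of the square root, 1 + N(R + 96c) that of the cubed logarithm, and T₀
  -- pays for horizons too short for the union bound.
  refine ⟨R + (1 + N * (R + 96 * c)) + T₀, by positivity, ?_⟩
  set C := R + (1 + N * (R + 96 * c)) + T₀ with hC
  have hC0 : 0 ≤ C := by positivity
  intro X Y Z Ω _ _ _ D _ ℓ hℓ H hH hm hs hsH hmin μ _ E U hE hU hind hmap δ hδ T hT
  rcases le_or_gt 1 δ with hδ1 | hδ1
  · exact (by linarith : 1 - δ ≤ 0).trans measureReal_nonneg
  have hNpos : 1 ≤ N := hH ▸ Finset.card_pos.2 ⟨hs, hsH⟩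
  obtain ⟨hΛ, hTΛ, hb, hl, ha⟩ := levels_le hT hNpos hδ hδ1 hc
  set Lam := Real.log (T / δ)
  have hΛ3 : 1 ≤ Lam ^ 3 := one_le_pow₀ hΛ
  have hL : 0 ≤ risk D ℓ hs := integral_nonneg fun e => (hℓ _ _).1
  have hθ : 0 ≤ thetaS D ℓ H hs := thetaS_nonneg
  set S := Real.sqrt (risk D ℓ hs * T * Lam) with hS
  have hS0 : 0 ≤ S := Real.sqrt_nonneg _
  -- For T < T₀ the rate is almost surely at most T < T₀, and C·Λ³ ≥ T₀.
  rcases lt_or_ge (T : ℝ) T₀ with hTs | hTl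
  · have h1 : ∀ᵐ ω ∂μ, ω ∈ {ω | expectedSamplingRate μ T δ ℓ H E U ω ≤
        thetaS D ℓ H hs * (4 * risk D ℓ hs * T + C * S) + C * Lam ^ 3} := by
      filter_upwards [expectedSamplingRate_le_rounds (T := T) (δ := δ) hℓ hE hU hind hmap hm]
        with ω hω
      have h2 : 0 ≤ thetaS D ℓ H hs * (4 * risk D ℓ hs * T + C * S) := by positivity
      have h3 : T₀ * 1 ≤ C * Lam ^ 3 := by
        gcongr
        linarith
      linarith
    calc 1 - δ ≤ 1 := by linarith
      _ = μ.real Set.univ := probReal_univ.symm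
      _ = _ := (measureReal_congr (Filter.eventuallyEq_univ.2 h1)).symm
  · subst hH
    refine measureReal_good_event hℓ hE hU hind hmap hm hsH hδ hδ1 hT hTl fun ω hdev hmass hce => ?_
    have hN' : (1 : ℝ) ≤ H.card := by exact_mod_cast hNpos
    have hT0 : (0 : ℝ) < T := by positivity
    have hb1 : 0 < globalLevel T H.card δ := zero_lt_one.trans_le
      ((one_le_log_nat hT).trans (log_le_globalLevel hT hNpos hδ hδ1))
    have hsum := sum_rate_le_of_recursion (T := T) (a := localLevel δ)
      (P := fun t => (state T δ ℓ H E U t ω).probSum)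
      (q := fun t => ∫ e, disagreement ℓ (state T δ ℓ H E U t ω).space e ∂D)
      hN' hc1 hθ (thetaS_le_card hℓ hm hsH) hL hΛ hTΛ hb hl ha (probSum_monotone hℓ ω)
      (fun t => probSum_nonneg hℓ t ω) hmass (integral_disagreement_le_one hℓ)
      (fun t ht htT => by
        obtain ⟨s, rfl⟩ : ∃ s, t = s + 1 := ⟨t - 1, by omega⟩
        refine integral_disagreement_space_le hℓ hm hsH hmin hdev (by omega) ?_
        rw [slack_eq]
        have h1 := Real.sqrt_pos.2 hb1
        have h2 := Real.sqrt_pos.2 (zero_lt_one.trans_le (one_le_localLevel hδ hδ1 ht))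
        positivity) hK (by omega)
    have hrate : expectedSamplingRate μ T δ ℓ H E U ω = ∑ t ∈ Finset.range T,
        ∫ e, disagreement ℓ (state T δ ℓ H E U t ω).space e ∂D :=
      Finset.sum_congr rfl fun t _ => hce t
    rw [Set.mem_ofPred_eq, hrate]
    refine hsum.trans ?_
    gcongr
    · linarith
    · linarith

end EIWeS

theorem theorem4 (N : ℕ) :
    ∃ C : ℝ, 0 < C ∧
      ∀ {X Y Z Ω : Type*} [MeasurableSpace X] [MeasurableSpace Y] [MeasurableSpace Ω]
        (D : MeasureTheory.Measure (X × Y)) [MeasureTheory.IsProbabilityMeasure D]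
        (ℓ : Z → Y → ℝ) (_ : ∀ z y, ℓ z y ∈ Set.Icc (0 : ℝ) 1)
        (H : Finset (X → Z)) (_ : H.card = N)
        (_ : ∀ h ∈ H, Measurable fun e : X × Y => ℓ (h e.1) e.2)
        (hs : X → Z) (_ : hs ∈ H) (_ : ∀ h ∈ H, EIWeS.risk D ℓ hs ≤ EIWeS.risk D ℓ h)
        (μ : MeasureTheory.Measure Ω) [MeasureTheory.IsProbabilityMeasure μ]
        (E : ℕ → Ω → X × Y) (U : ℕ → Ω → ℝ)
        (_ : ∀ t, Measurable (E t)) (_ : ∀ t, Measurable (U t))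
        (_ : ProbabilityTheory.iIndepFun (fun t ω => (E t ω, U t ω)) μ)
        (_ : ∀ t, MeasureTheory.Measure.map (fun ω => (E t ω, U t ω)) μ =
          D.prod (MeasureTheory.volume.restrict (Set.Icc (0 : ℝ) 1)))
        (δ : ℝ) (_ : 0 < δ) (T : ℕ) (_ : 3 ≤ T),
        1 - δ ≤ μ.real {ω | EIWeS.expectedSamplingRate μ T δ ℓ H E U ω ≤
          EIWeS.thetaS D ℓ H hs *
              (4 * EIWeS.risk D ℓ hs * T +
                C * Real.sqrt (EIWeS.risk D ℓ hs * T * Real.log (T / δ))) +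
            C * Real.log (T / δ) ^ 3} ∧
        (EIWeS.risk D ℓ hs = 0 →
          1 - δ ≤ μ.real {ω | EIWeS.expectedSamplingRate μ T δ ℓ H E U ω ≤
            C * Real.log (T / δ) ^ 3}) := by
  obtain ⟨C, hC, h⟩ := EIWeS.exists_rate_constant N
  refine ⟨C, hC, ?_⟩
  intro X Y Z Ω _ _ _ D _ ℓ hℓ H hH hm hs hsH hmin μ _ E U hE hU hind hmap δ hδ T hT
  have h1 := h D ℓ hℓ H hH hm hs hsH hmin μ E U hE hU hind hmap δ hδ T hT
  refine ⟨h1, fun h0 => ?_⟩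
  simpa only [h0, mul_zero, zero_mul, Real.sqrt_zero, add_zero, zero_add] using h1
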